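/- Let $M$ be a connected smooth (real, finite-dimensional, Hausdorff, second-countable, boundaryless) manifold with $\dim M\ge 2$, let $\nabla$ be a smooth affine connection on $M$, and let $h$ be a complete smooth Riemannian metric on $M$, with norm $|\cdot|_h$. Let $\exp:\mathcal D\subset TM\to M$ be the exponential map of $\nabla$ on its maximal domain $\mathcal D$ (the set of $v\in TM$ such that the $\nabla$-geodesic with initial velocity $v$ is defined up to time $1$), let $\pi:TM\to M$ be the projection and $\mathcal Z\subset TM$ the set of zero vectors. Let $C\subset\mathcal D$ be a non-empty set such that (P1) for every $v\in C$ there is $v'\in C\setminus\mathcal Z$ with $\pi(v')=\pi(v)$; (P2) for every $v\in C\setminus\mathcal Z$, $(\mathbb R\cdot v)\cap\mathcal D\subset C$. Put $C_1=\{v/|v|_h : v\in C\setminus\mathcal Z\}$, $J_w=\{t\in\mathbb R : t\cdot w\in\mathcal D\}$ for $w\in C_1$, and $$\mathcal C=\{\gamma: t\in I\mapsto \exp(t\cdot w)\in M \ :\ w\in C_1,\ I\subset J_w \text{ a non-degenerate interval}\}.$$ A collection of non-constant geodesics is called *pseudoconvex* if for every compact $K\subset M$ there is a compact $K^*\subset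 M$ such that every segment, with endpoints in $K$, of a geodesic of the collection is contained in $K^*$. It is called *disprisoning* if for every maximal extension $\gamma:(a,b)\to M$ ($-\infty\le a<b\le+\infty$) of a geodesic of the collection and every $t_0\in(a,b)$, neither $\overline{\gamma([t_0,b))}$ nor $\overline{\gamma((a,t_0])}$ is compact. A map is *proper* if inverse images of compact sets are compact. **Theorem.** (i) If $\exp|_C:C\to M$ is proper, then $\mathcal C$ is pseudoconvex and disprisoning. (ii) If $C\cap\mathcal Z$ is compact and $C$ is closed in $\mathcal D$, then conversely, if $\mathcal C$ is pseudoconvex and disprisoning, $\exp|_C$ is proper. -/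

import Mathlib

open Set Filter Topology Bundle
open scoped Manifold ContDiff ENNReal

noncomputable section

namespace AffineGeodesics

/-- An affine connection on `M`, i.e. a covariant derivative on the tangent bundle of `M`. In
Mathlib's convention `cov Y x u` is `(∇_u Y)(x)`. -/
abbrev AffineConnection (E : Type*) [NormedAddCommGroup E] [NormedSpace ℝ E]
    (M : Type*) [TopologicalSpace M] [ChartedSpace E M] [IsManifold 𝓘(ℝ, E) ∞ M] :=
  CovariantDerivative 𝓘(ℝ, E) E (fun x : M => TangentSpace 𝓘(ℝ, E) x)

/-- A smooth Riemannian metric on `M`. -/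
abbrev SmoothRiemannianMetric (E : Type*) [NormedAddCommGroup E] [NormedSpace ℝ E]
    (M : Type*) [TopologicalSpace M] [ChartedSpace E M] [IsManifold 𝓘(ℝ, E) ∞ M] :=
  ContMDiffRiemannianMetric 𝓘(ℝ, E) ∞ E (fun x : M => TangentSpace 𝓘(ℝ, E) x)

section

variable {E : Type*} [NormedAddCommGroup E] [NormedSpace ℝ E]
  {M : Type*} [TopologicalSpace M] [ChartedSpace E M] [IsManifold 𝓘(ℝ, E) ∞ M]

/-! ### The auxiliary Riemannian metric -/

/-- The Riemannian distance `d_h`: the infimum of the `h`-lengths of `C¹` paths. -/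
def riemDist (h : SmoothRiemannianMetric E M) (x y : M) : ℝ≥0∞ :=
  letI : RiemannianBundle (fun x : M => TangentSpace 𝓘(ℝ, E) x) := ⟨h.toRiemannianMetric⟩
  Manifold.riemannianEDist 𝓘(ℝ, E) x y

/-- `h` is complete: every `d_h`-Cauchy sequence is `d_h`-convergent. -/
def IsCompleteMetric (h : SmoothRiemannianMetric E M) : Prop :=
  ∀ u : ℕ → M,
    (∀ ε : ℝ≥0∞, 0 < ε → ∃ N, ∀ m ≥ N, ∀ n ≥ N, riemDist h (u m) (u n) < ε) →
      ∃ x, Tendsto (fun n => riemDist h (u n) x) atTop (𝓝 0)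

/-- The `h`-norm of a tangent vector. -/
def hNorm (h : SmoothRiemannianMetric E M) (v : TangentBundle 𝓘(ℝ, E) M) : ℝ :=
  Real.sqrt (h.inner v.proj v.snd v.snd)

/-! ### Geodesics -/

/-- The velocity `t ↦ γ'(t)`, as a curve in the tangent bundle. -/
def velocity (γ : ℝ → M) (t : ℝ) : TangentBundle 𝓘(ℝ, E) M :=
  ⟨γ t, mfderiv 𝓘(ℝ, ℝ) 𝓘(ℝ, E) γ t (1 : ℝ)⟩

/-- The covariant derivative `(DV/dt)(t)` of a vector field `V` along a curve `γ`. In the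
coordinate frame `∂ᵢ` around `γ t`, with `V = ∑ Vⁱ ∂ᵢ`, this is
`∑ (Vⁱ)'(t) ∂ᵢ + Vⁱ(t) ∇_{γ'(t)} ∂ᵢ`: the first summand below is the derivative of the
component vector of `V`, the second one is the connection applied to the local field with constant
components `Vⁱ(t)`. -/
def covDerivAlong (cov : AffineConnection E M) (γ : ℝ → M)
    (V : ∀ s : ℝ, TangentSpace 𝓘(ℝ, E) (γ s)) (t : ℝ) : TangentSpace 𝓘(ℝ, E) (γ t) :=
  let e := trivializationAt E (fun x : M => TangentSpace 𝓘(ℝ, E) x) (γ t)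
  let comp : ℝ → E := fun s => (e ⟨γ s, V s⟩).2
  e.symmL ℝ (γ t) (deriv comp t) +
    cov (fun y => e.symmL ℝ y (comp t)) (γ t) (mfderiv 𝓘(ℝ, ℝ) 𝓘(ℝ, E) γ t (1 : ℝ))

/-- `γ` is a geodesic on the open interval `s`: it is twice differentiable there (its velocity is a
differentiable curve in the tangent bundle) and `∇_{γ'} γ' = 0`. By the geodesic equation such a
curve is automatically smooth. The values of `γ` off `s` are irrelevant. -/
structure IsGeodesicOn (cov : AffineConnection E M) (γ : ℝ → M) (s : Set ℝ) : Prop where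
  isOpen : IsOpen s
  ordConnected : s.OrdConnected
  mdifferentiableAt : ∀ t ∈ s, MDifferentiableAt 𝓘(ℝ, ℝ) 𝓘(ℝ, E) γ t
  mdifferentiableAt_velocity : ∀ t ∈ s,
    MDifferentiableAt 𝓘(ℝ, ℝ) 𝓘(ℝ, E).tangent (velocity (E := E) γ) t
  acceleration_eq_zero : ∀ t ∈ s,
    covDerivAlong cov γ (fun r => (velocity (E := E) γ r).snd) t = 0

/-- `γ : s → M` is a maximally extended (inextendible) geodesic, `s` a nonempty open interval. -/
structure IsMaximalGeodesic (cov : AffineConnection E M) (γ : ℝ → M) (s : Set ℝ) : Prop where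
  isGeodesicOn : IsGeodesicOn cov γ s
  nonempty : s.Nonempty
  maximal : ∀ (γ' : ℝ → M) (s' : Set ℝ), IsGeodesicOn cov γ' s' → s ⊆ s' → EqOn γ' γ s → s' ⊆ s

/-! ### The exponential map -/

/-- `γ` is a geodesic on an open interval containing `[0,1]` with initial velocity `v`. -/
def IsUnitTimeGeodesic (cov : AffineConnection E M) (v : TangentBundle 𝓘(ℝ, E) M)
    (γ : ℝ → M) : Prop :=
  ∃ s : Set ℝ, 0 ∈ s ∧ 1 ∈ s ∧ IsGeodesicOn cov γ s ∧ velocity γ 0 = v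

/-- The maximal domain `𝒟 ⊆ TM` of the exponential map: the vectors `v` for which the geodesic
with initial velocity `v` is defined up to time `1`. -/
def expDomain (cov : AffineConnection E M) : Set (TangentBundle 𝓘(ℝ, E) M) :=
  {v | ∃ γ : ℝ → M, IsUnitTimeGeodesic cov v γ}

open Classical in
/-- The exponential map: for `v ∈ 𝒟`, `exp v = γ(1)` where `γ` is the geodesic with initial velocity
`v`; its value off `𝒟` is irrelevant. -/
def expMap (cov : AffineConnection E M) (v : TangentBundle 𝓘(ℝ, E) M) : M :=
  if hv : ∃ γ : ℝ → M, IsUnitTimeGeodesic cov v γ then hv.choose 1 else v.proj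

/-- Fibrewise scalar multiplication `t · v` on the tangent bundle. -/
def scale (t : ℝ) (v : TangentBundle 𝓘(ℝ, E) M) : TangentBundle 𝓘(ℝ, E) M :=
  ⟨v.proj, t • v.snd⟩

variable (E M) in
/-- The range `𝒵` of the zero section of the tangent bundle. -/
def zeroVectors : Set (TangentBundle 𝓘(ℝ, E) M) := {v | v.snd = 0}

/-! ### The class of geodesics determined by a set of vectors -/

/-- Property (P1): over the base point of each vector of `C` there is a nonzero vector of `C`. -/
def PropertyP1 (C : Set (TangentBundle 𝓘(ℝ, E) M)) : Prop :=
  ∀ v ∈ C, ∃ v' ∈ C \ zeroVectors E M, v'.proj = v.proj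

/-- Property (P2): `(ℝ · v) ∩ 𝒟 ⊆ C` for every nonzero `v ∈ C`. -/
def PropertyP2 (cov : AffineConnection E M) (C : Set (TangentBundle 𝓘(ℝ, E) M)) : Prop :=
  ∀ v ∈ C \ zeroVectors E M, range (fun t : ℝ => scale t v) ∩ expDomain cov ⊆ C

/-- `C₁`, the set of `h`-normalizations of the nonzero vectors of `C`. -/
def unitVectors (h : SmoothRiemannianMetric E M) (C : Set (TangentBundle 𝓘(ℝ, E) M)) :
    Set (TangentBundle 𝓘(ℝ, E) M) :=
  (fun v => scale (hNorm h v)⁻¹ v) '' (C \ zeroVectors E M)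

/-- `J_w = {t ∈ ℝ : t · w ∈ 𝒟}`. -/
def timeInterval (cov : AffineConnection E M) (w : TangentBundle 𝓘(ℝ, E) M) : Set ℝ :=
  {t | scale t w ∈ expDomain cov}

/-- The collection of the curves `t ∈ I ↦ exp (t · w)`, with `w ∈ C₁` and `I ⊆ J_w` a nondegenerate
interval. A curve with domain `I` is represented by a pair `(I, γ)`, the values of `γ` off `I` being
irrelevant. -/
def geodesicClass (cov : AffineConnection E M) (h : SmoothRiemannianMetric E M)
    (C : Set (TangentBundle 𝓘(ℝ, E) M)) : Set (Set ℝ × (ℝ → M)) :=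
  {c | c.1.OrdConnected ∧ c.1.Nontrivial ∧ ∃ w ∈ unitVectors h C,
    c.1 ⊆ timeInterval cov w ∧ ∀ t ∈ c.1, c.2 t = expMap cov (scale t w)}

/-! ### Pseudoconvexity, disprisonment, properness -/

/-- A collection of curves is pseudoconvex if for every compact `K` there is a compact `K'` which
contains every segment, with endpoints in `K`, of a curve of the collection. -/
def IsPseudoconvex (𝒞 : Set (Set ℝ × (ℝ → M))) : Prop :=
  ∀ K : Set M, IsCompact K → ∃ K' : Set M, IsCompact K' ∧
    ∀ c ∈ 𝒞, ∀ a ∈ c.1, ∀ b ∈ c.1, a ≤ b → c.2 a ∈ K → c.2 b ∈ K → c.2 '' Icc a b ⊆ K'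

/-- A collection of geodesics is disprisoning if, for each maximal extension `γ : s → M` of one of
its members and each `t₀ ∈ s`, neither half `γ(s ∩ [t₀, ∞))`, `γ(s ∩ (-∞, t₀])` has compact
closure. -/
def IsDisprisoning (cov : AffineConnection E M) (𝒞 : Set (Set ℝ × (ℝ → M))) : Prop :=
  ∀ c ∈ 𝒞, ∀ (γ : ℝ → M) (s : Set ℝ), IsMaximalGeodesic cov γ s → c.1 ⊆ s → EqOn γ c.2 c.1 →
    ∀ t₀ ∈ s, ¬ IsCompact (closure (γ '' (s ∩ Ici t₀))) ∧
      ¬ IsCompact (closure (γ '' (s ∩ Iic t₀)))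

/-- A map is proper if inverse images of compact sets are compact. -/
def HasCompactPreimages {X Y : Type*} [TopologicalSpace X] [TopologicalSpace Y] (f : X → Y) :
    Prop :=
  ∀ K : Set Y, IsCompact K → IsCompact (f ⁻¹' K)

end

end AffineGeodesics

end

/-! Write `𝒟` for the domain of `exp`. The theorem needs four facts from the theory of ordinary
differential equations: `𝒟` is open, it is fibrewise star-shaped, `exp` is continuous on it, and `t
↦ exp (t w)` on `J_w` is the maximal geodesic with initial velocity `w`. They follow from local
existence, uniqueness and continuous dependence for the geodesic equation in a chart
(`exists_local_geodesic_flow`, `velocity_eventuallyEq`), propagated along a whole geodesic by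
connectedness (`IsGeodesicOn.eqOn_velocity`, `eventually_reaches`).

Proper implies pseudoconvex: if `exp (a w)` and `exp (b w)` lie in a compact `K`, then `a w` and `b
w` lie in the compact set `C ∩ exp⁻¹ K`, and `x w` with `x ∈ [a, b]` is a contraction of one of them
towards zero. The segment therefore lies in the image under `exp` of `[0, 1] · (C ∩ exp⁻¹ K)`, which
is compact.

Proper implies disprisoning: for a unit vector `w`, the times at which `exp (t w)` lies in a compact
set form a compact subset of the open interval `J_w`. Such a set contains no half of `J_w`, since
its extremal time could always be passed.

Conversely, take an ultrafilter on `C ∩ exp⁻¹ K` and write its vectors as `t w` with `w ∈ C₁` and `t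
≥ 0`. The base points stay in the compact set `π(C ∩ 𝒵)`, so the directions converge, and the limit
`w` is in `C₁` because `C` is closed in `𝒟`. The times converge in `[0, ∞]` to some `τ`. If `τ ∈
J_w`, the vectors converge to `τ w`. Otherwise every point of the forward half of the geodesic of
`w` is a limit of points on segments joining `π(C ∩ 𝒵)` to `K`. Pseudoconvexity confines these to
one compact set, which contradicts disprisonment. -/

noncomputable section

namespace AffineGeodesics

/-! ### A connection in a trivialization: flat part plus connection form. -/

section Trivialization

variable {E : Type*} [NormedAddCommGroup E] [NormedSpace ℝ E]
  {M : Type*} [TopologicalSpace M] [ChartedSpace E M] [IsManifold 𝓘(ℝ, E) ∞ M]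

omit [IsManifold 𝓘(ℝ, E) ∞ M] in
lemma mvfderiv_congr {f g : M → E} {x : M} (h : f =ᶠ[𝓝 x] g) :
    mvfderiv 𝓘(ℝ, E) f x = mvfderiv 𝓘(ℝ, E) g x :=
  h.mfderiv_eq

variable (e : Trivialization E (TotalSpace.proj : TangentBundle 𝓘(ℝ, E) M → M))
  [MemTrivializationAtlas e]

/-- The section with components `f` in the trivialization `e`. -/
def sectionOf (f : M → E) (y : M) : TangentSpace 𝓘(ℝ, E) y := e.symmL ℝ y (f y)

lemma trivialization_sectionOf {f : M → E} {y : M} (hy : y ∈ e.baseSet) :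
    (e ⟨y, sectionOf e f y⟩).2 = f y := by
  rw [← e.continuousLinearMapAt_apply_of_mem (R := ℝ) hy]
  exact e.continuousLinearMapAt_symmL hy _

lemma symmL_trivialization {y : M} (hy : y ∈ e.baseSet) (v : TangentSpace 𝓘(ℝ, E) y) :
    e.symmL ℝ y (e ⟨y, v⟩).2 = v := by
  rw [← e.continuousLinearMapAt_apply_of_mem (R := ℝ) hy]
  exact e.symmL_continuousLinearMapAt hy _

lemma mdifferentiableAt_components_iff {σ : ∀ y : M, TangentSpace 𝓘(ℝ, E) y} {x : M}
    (hx : x ∈ e.baseSet) :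
    MDifferentiableAt 𝓘(ℝ, E) (𝓘(ℝ, E).prod 𝓘(ℝ, E)) (fun y => (⟨y, σ y⟩ : TangentBundle 𝓘(ℝ, E) M)) x ↔
      MDifferentiableAt 𝓘(ℝ, E) 𝓘(ℝ, E) (fun y => (e ⟨y, σ y⟩).2) x :=
  e.mdifferentiableAt_section_iff 𝓘(ℝ, E) σ hx

lemma mdifferentiableAt_sectionOf {f : M → E} {x : M} (hx : x ∈ e.baseSet)
    (hf : MDifferentiableAt 𝓘(ℝ, E) 𝓘(ℝ, E) f x) :
    MDifferentiableAt 𝓘(ℝ, E) (𝓘(ℝ, E).prod 𝓘(ℝ, E))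
      (fun y => (⟨y, sectionOf e f y⟩ : TangentBundle 𝓘(ℝ, E) M)) x := by
  rw [mdifferentiableAt_components_iff e hx]
  refine hf.congr_of_eventuallyEq ?_
  filter_upwards [e.open_baseSet.mem_nhds hx] with y hy using trivialization_sectionOf e hy

lemma contMDiffAt_sectionOf {f : M → E} {x : M} (hx : x ∈ e.baseSet)
    (hf : ContMDiffAt 𝓘(ℝ, E) 𝓘(ℝ, E) ∞ f x) :
    ContMDiffAt 𝓘(ℝ, E) (𝓘(ℝ, E).prod 𝓘(ℝ, E)) ∞
      (fun y => (⟨y, sectionOf e f y⟩ : TangentBundle 𝓘(ℝ, E) M)) x := by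
  rw [e.contMDiffAt_section_iff hx]
  refine hf.congr_of_eventuallyEq ?_
  filter_upwards [e.open_baseSet.mem_nhds hx] with y hy using trivialization_sectionOf e hy

/-- The flat connection of a trivialization. -/
def flatConnection (σ : ∀ y : M, TangentSpace 𝓘(ℝ, E) y) (y : M) :
    TangentSpace 𝓘(ℝ, E) y →L[ℝ] TangentSpace 𝓘(ℝ, E) y :=
  (e.symmL ℝ y).comp (mvfderiv 𝓘(ℝ, E) (fun z => (e ⟨z, σ z⟩).2) y)

/-- A trivialization is linear on fibres, so additivity and the Leibniz rule reduce to those for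
vector-valued functions. This provides the reference connection against which `cov` is compared. -/
lemma isCovariantDerivativeOn_flatConnection :
    IsCovariantDerivativeOn (I := 𝓘(ℝ, E)) E (flatConnection e) e.baseSet where
  add {σ σ' x} hσ hσ' hx := by
    rw [mdifferentiableAt_components_iff e hx] at hσ hσ'
    have : (fun z => (e ⟨z, (σ + σ') z⟩).2) =ᶠ[𝓝 x]
        (fun z => (e ⟨z, σ z⟩).2) + fun z => (e ⟨z, σ' z⟩).2 := by
      filter_upwards [e.open_baseSet.mem_nhds hx] with y hy
      exact (e.linear ℝ hy).map_add _ _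
    rw [flatConnection, mvfderiv_congr this, mvfderiv_add hσ hσ']
    exact ContinuousLinearMap.comp_add _ _ _
  leibniz {σ g x} hσ hg hx := by
    rw [mdifferentiableAt_components_iff e hx] at hσ
    have : (fun z => (e ⟨z, (g • σ) z⟩).2) =ᶠ[𝓝 x] g • (fun z => (e ⟨z, σ z⟩).2) := by
      filter_upwards [e.open_baseSet.mem_nhds hx] with y hy
      exact (e.linear ℝ hy).map_smul _ _
    rw [flatConnection, mvfderiv_congr this, mvfderiv_smul hg hσ]
    ext v
    simp only [flatConnection, ContinuousLinearMap.comp_apply, add_apply,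
      smul_apply, ContinuousLinearMap.smulRight_apply, map_add, map_smul]
    rw [symmL_trivialization e hx]

lemma flatConnection_sectionOf {f : M → E} {x : M} (hx : x ∈ e.baseSet) :
    flatConnection e (sectionOf e f) x = (e.symmL ℝ x).comp (mvfderiv 𝓘(ℝ, E) f x) := by
  have : (fun z => (e ⟨z, sectionOf e f z⟩).2) =ᶠ[𝓝 x] f := by
    filter_upwards [e.open_baseSet.mem_nhds hx] with y hy using trivialization_sectionOf e hy
  rw [flatConnection, mvfderiv_congr this]

variable [FiniteDimensional ℝ E]

/-- The connection form of `cov` in the trivialization `e`. -/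
def connectionForm (cov : AffineConnection E M) (x : M) :
    TangentSpace 𝓘(ℝ, E) x →L[ℝ] TangentSpace 𝓘(ℝ, E) x →L[ℝ] TangentSpace 𝓘(ℝ, E) x :=
  IsCovariantDerivativeOn.difference (s := e.baseSet) cov.isCovariantDerivativeOn
    (isCovariantDerivativeOn_flatConnection e) x

/-- The difference of two covariant derivatives is tensorial, so it sees only the value `f x`; the
flat part contributes the derivative of `f`. -/
lemma cov_sectionOf (cov : AffineConnection E M) {f : M → E} {x : M} (hx : x ∈ e.baseSet)
    (hf : MDifferentiableAt 𝓘(ℝ, E) 𝓘(ℝ, E) f x) (u : TangentSpace 𝓘(ℝ, E) x) :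
    cov (sectionOf e f) x u =
      connectionForm e cov x (e.symmL ℝ x (f x)) u + e.symmL ℝ x (mvfderiv 𝓘(ℝ, E) f x u) := by
  have h := IsCovariantDerivativeOn.difference_apply (s := e.baseSet) (I := 𝓘(ℝ, E))
    cov.isCovariantDerivativeOn (isCovariantDerivativeOn_flatConnection e) hx
    (mdifferentiableAt_sectionOf e hx hf)
  rw [flatConnection_sectionOf e hx] at h
  have h' := congrArg (fun L => L u) h
  simp only [sub_apply, ContinuousLinearMap.comp_apply] at h'
  exact eq_add_of_sub_eq h'.symm

lemma cov_sectionOf_const (cov : AffineConnection E M) (c : E) {x : M} (hx : x ∈ e.baseSet)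
    (u : TangentSpace 𝓘(ℝ, E) x) :
    cov (sectionOf e fun _ => c) x u = connectionForm e cov x (e.symmL ℝ x c) u := by
  rw [cov_sectionOf e cov hx mdifferentiableAt_const, mvfderiv_const]
  simp

end Trivialization

/-! ### Covariant derivative along a curve, independently of the frame. -/

section CovDeriv

variable {E : Type*} [NormedAddCommGroup E] [NormedSpace ℝ E]
  {M : Type*} [TopologicalSpace M] [ChartedSpace E M] [IsManifold 𝓘(ℝ, E) ∞ M]

omit [IsManifold 𝓘(ℝ, E) ∞ M] in
lemma hasDerivAt_comp_curve {F : Type*} [NormedAddCommGroup F] [NormedSpace ℝ F]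
    {f : M → F} {γ : ℝ → M} {t : ℝ} (hf : MDifferentiableAt 𝓘(ℝ, E) 𝓘(ℝ, F) f (γ t))
    (hγ : MDifferentiableAt 𝓘(ℝ, ℝ) 𝓘(ℝ, E) γ t) :
    HasDerivAt (fun s => f (γ s))
      (mvfderiv 𝓘(ℝ, E) f (γ t) (mfderiv 𝓘(ℝ, ℝ) 𝓘(ℝ, E) γ t (1 : ℝ))) t := by
  have h : HasFDerivAt (fun s => f (γ s))
      ((mvfderiv 𝓘(ℝ, E) f (γ t)).comp (mfderiv 𝓘(ℝ, ℝ) 𝓘(ℝ, E) γ t) : ℝ →L[ℝ] F) t :=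
    (hf.hasMFDerivAt.comp t hγ.hasMFDerivAt).hasFDerivAt
  exact h.hasDerivAt

variable (e : Trivialization E (TotalSpace.proj : TangentBundle 𝓘(ℝ, E) M → M))
  [MemTrivializationAtlas e]

/-- The components of a differentiable curve in the tangent bundle are differentiable. -/
lemma differentiableAt_components {c : ℝ → TangentBundle 𝓘(ℝ, E) M} {t : ℝ}
    (ht : (c t).proj ∈ e.baseSet) (hc : MDifferentiableAt 𝓘(ℝ, ℝ) 𝓘(ℝ, E).tangent c t) :
    DifferentiableAt ℝ (fun s => (e (c s)).2) t :=
  ((e.mdifferentiableAt_totalSpace_iff 𝓘(ℝ, E) c (e.mem_source.mpr ht)).1 hc).2.differentiableAt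

variable [FiniteDimensional ℝ E]

/-- The covariant derivative along a curve can be computed in any trivialization. -/
theorem covDerivAlong_eq (cov : AffineConnection E M) {γ : ℝ → M}
    {V : ∀ s : ℝ, TangentSpace 𝓘(ℝ, E) (γ s)} {t : ℝ} (ht : γ t ∈ e.baseSet)
    (hγ : MDifferentiableAt 𝓘(ℝ, ℝ) 𝓘(ℝ, E) γ t)
    (hV : MDifferentiableAt 𝓘(ℝ, ℝ) 𝓘(ℝ, E).tangent
      (fun s => (⟨γ s, V s⟩ : TangentBundle 𝓘(ℝ, E) M)) t) :
    covDerivAlong cov γ V t =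
      e.symmL ℝ (γ t) (deriv (fun s => (e ⟨γ s, V s⟩).2) t) +
        cov (sectionOf e fun _ => (e ⟨γ t, V t⟩).2) (γ t)
          (mfderiv 𝓘(ℝ, ℝ) 𝓘(ℝ, E) γ t (1 : ℝ)) := by
  set e₁ := trivializationAt E (fun x : M => TangentSpace 𝓘(ℝ, E) x) (γ t) with he₁
  have ht₁ : γ t ∈ e₁.baseSet := mem_baseSet_trivializationAt _ _ _
  set u := mfderiv 𝓘(ℝ, ℝ) 𝓘(ℝ, E) γ t (1 : ℝ) with hu
  set comp : ℝ → E := fun s => (e ⟨γ s, V s⟩).2 with hcomp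
  set A : M → E →L[ℝ] E := fun y => (e.coordChangeL ℝ e₁ y : E →L[ℝ] E) with hA
  have hnhds : e.baseSet ∩ e₁.baseSet ∈ 𝓝 (γ t) :=
    (e.open_baseSet.inter e₁.open_baseSet).mem_nhds ⟨ht, ht₁⟩
  have hAmd : MDifferentiableAt 𝓘(ℝ, E) 𝓘(ℝ, E →L[ℝ] E) A (γ t) :=
    mdifferentiableAt_coordChangeL ht ht₁
  have hA_apply : ∀ y ∈ e.baseSet ∩ e₁.baseSet, ∀ c, A y c = (e₁ ⟨y, e.symmL ℝ y c⟩).2 := by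
    intro y hy c
    rw [e.symmL_apply hy.1]
    exact e.coordChangeL_apply e₁ hy c
  have hcomp' : HasDerivAt comp (deriv comp t) t :=
    (differentiableAt_components e (c := fun s => ⟨γ s, V s⟩) ht hV).hasDerivAt
  have hcomp₁ : (fun s => (e₁ ⟨γ s, V s⟩).2) =ᶠ[𝓝 t] fun s => A (γ s) (comp s) := by
    filter_upwards [hγ.continuousAt hnhds] with s hs
    rw [hA_apply _ hs, symmL_trivialization e hs.1]
  have hderiv : deriv (fun s => (e₁ ⟨γ s, V s⟩).2) t =
      (mvfderiv 𝓘(ℝ, E) A (γ t) u) (comp t) + A (γ t) (deriv comp t) := by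
    rw [hcomp₁.deriv_eq]
    exact ((hasDerivAt_comp_curve hAmd hγ).clm_apply hcomp').deriv
  have hAc : MDifferentiableAt 𝓘(ℝ, E) 𝓘(ℝ, E) (fun y => A y (comp t)) (γ t) :=
    hAmd.clm_apply mdifferentiableAt_const
  have hAc' : mvfderiv 𝓘(ℝ, E) (fun y => A y (comp t)) (γ t) u =
      (mvfderiv 𝓘(ℝ, E) A (γ t) u) (comp t) := by
    have h₁ := hasDerivAt_comp_curve hAc hγ
    have h₂ := (hasDerivAt_comp_curve hAmd hγ).clm_apply (hasDerivAt_const t (comp t))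
    have := h₁.unique h₂
    simpa using this
  have hsec : sectionOf e (fun _ => comp t) =ᶠ[𝓝 (γ t)] sectionOf e₁ fun y => A y (comp t) := by
    filter_upwards [hnhds] with y hy
    rw [sectionOf, sectionOf, hA_apply _ hy, symmL_trivialization e₁ hy.2]
  have hcov : cov (sectionOf e fun _ => comp t) (γ t) =
      cov (sectionOf e₁ fun y => A y (comp t)) (γ t) :=
    cov.isCovariantDerivativeOn.congr_of_eventuallyEq (s := univ)
      (mdifferentiableAt_sectionOf e ht mdifferentiableAt_const)
      (mdifferentiableAt_sectionOf e₁ ht₁ hAc) univ_mem hsec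
  have hA₁ : e₁.symmL ℝ (γ t) (A (γ t) (deriv comp t)) = e.symmL ℝ (γ t) (deriv comp t) := by
    rw [hA_apply _ ⟨ht, ht₁⟩, symmL_trivialization e₁ ht₁]
  have hct : (e₁ ⟨γ t, V t⟩).2 = A (γ t) (comp t) := hcomp₁.self_of_nhds
  have hL : covDerivAlong cov γ V t = e₁.symmL ℝ (γ t) (deriv (fun s => (e₁ ⟨γ s, V s⟩).2) t) +
      cov (sectionOf e₁ fun _ => (e₁ ⟨γ t, V t⟩).2) (γ t) u := rfl
  -- Both sides acquire the same term, the derivative of the coordinate change `A` in the direction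
  -- `u`: on the left from the product rule, on the right from the varying components in `e₁` of the
  -- section that is constant in `e`.
  rw [hL, hcov, cov_sectionOf e₁ cov ht₁ hAc, cov_sectionOf_const e₁ cov _ ht₁, hderiv, hAc',
    map_add, hA₁, hct]
  abel

end CovDeriv

/-! ### Smoothness of the geodesic vector field. -/

section Spray

variable {E : Type*} [NormedAddCommGroup E] [NormedSpace ℝ E] [FiniteDimensional ℝ E]
  {M : Type*} [TopologicalSpace M] [ChartedSpace E M] [IsManifold 𝓘(ℝ, E) ∞ M]

section

variable (e : Trivialization E (TotalSpace.proj : TangentBundle 𝓘(ℝ, E) M → M))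
  [MemTrivializationAtlas e]

/-- Smoothness of `cov` is applied to globally smooth sections. The section with constant components
is smooth only over the base set, so it is cut off by a bump function equal to `1` near `x`;
locality of `cov` shows that nothing changes there. -/
lemma contMDiffAt_cov_sectionOf_const [T2Space M] (cov : AffineConnection E M)
    [hcov : CovariantDerivative.ContMDiffCovariantDerivative cov ∞] (c : E) {x : M}
    (hx : x ∈ e.baseSet) :
    ContMDiffAt 𝓘(ℝ, E) (𝓘(ℝ, E).prod 𝓘(ℝ, E →L[ℝ] E)) ∞
      (fun y => TotalSpace.mk' (E →L[ℝ] E)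
        (E := fun y : M => TangentSpace 𝓘(ℝ, E) y →L[ℝ] TangentSpace 𝓘(ℝ, E) y)
        y (cov (sectionOf e fun _ => c) y)) x := by
  obtain ⟨ψ, -, hψ⟩ := (SmoothBumpFunction.nhds_basis_tsupport (I := 𝓘(ℝ, E)) x).mem_iff.1
    (e.open_baseSet.mem_nhds hx)
  have hψ1 : ∀ᶠ y in 𝓝 x, ψ y = 1 := ψ.eventuallyEq_one
  have hsec : ∀ y ∈ e.baseSet, ContMDiffAt 𝓘(ℝ, E) (𝓘(ℝ, E).prod 𝓘(ℝ, E)) ∞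
      (fun y => (⟨y, sectionOf e (fun _ => c) y⟩ : TangentBundle 𝓘(ℝ, E) M)) y := fun y hy =>
    contMDiffAt_sectionOf e hy contMDiffAt_const
  have hσ : ContMDiff 𝓘(ℝ, E) (𝓘(ℝ, E).prod 𝓘(ℝ, E)) ∞
      (fun y => (⟨y, ((ψ : M → ℝ) • sectionOf e fun _ => c) y⟩ : TangentBundle 𝓘(ℝ, E) M)) := by
    intro y
    by_cases hy : y ∈ tsupport ψ
    · exact ψ.contMDiffAt.smul_section (hsec y (hψ hy))
    · refine (Bundle.contMDiffAt_zeroSection ℝ (fun x : M => TangentSpace 𝓘(ℝ, E) x)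
        (IB := 𝓘(ℝ, E)) (x := y)).congr_of_eventuallyEq ?_
      filter_upwards [(isClosed_tsupport ψ).isOpen_compl.mem_nhds hy] with z hz
      have : ψ z = 0 := image_eq_zero_of_notMem_tsupport hz
      simp [zeroSection, this]
  have h := hcov.contMDiff.contMDiff (σ := (ψ : M → ℝ) • sectionOf e fun _ => c) hσ.contMDiffOn
  refine (h.contMDiffAt univ_mem).congr_of_eventuallyEq ?_
  filter_upwards [hψ1.eventually_nhds, e.open_baseSet.mem_nhds hx] with y hy hy'
  have : cov (sectionOf e fun _ => c) y = cov ((ψ : M → ℝ) • sectionOf e fun _ => c) y := by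
    refine cov.isCovariantDerivativeOn.congr_of_eventuallyEq (s := univ)
      (mdifferentiableAt_sectionOf e hy' mdifferentiableAt_const)
      ((hσ y).mdifferentiableAt (by simp)) univ_mem ?_
    filter_upwards [hy] with z hz
    simp [hz]
  simp only [this]

/-- The coefficients of the connection in a trivialization are smooth. -/
lemma contMDiffAt_coefficient [T2Space M] (cov : AffineConnection E M)
    [CovariantDerivative.ContMDiffCovariantDerivative cov ∞] (c d : E) {x : M}
    (hx : x ∈ e.baseSet) :
    ContMDiffAt 𝓘(ℝ, E) 𝓘(ℝ, E) ∞ (fun y =>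
      (e ⟨y, cov (sectionOf e fun _ => c) y (sectionOf e (fun _ => d) y)⟩).2) x := by
  have h := (contMDiffAt_cov_sectionOf_const e cov c hx).clm_bundle_apply
    (contMDiffAt_sectionOf e (f := fun _ => d) hx contMDiffAt_const)
  exact (e.contMDiffAt_section_iff hx).1 h

/-- The expression is bilinear in its two entries. Expanding in a basis separates position from
velocity, so joint smoothness follows from smoothness of finitely many functions of the position. -/
lemma coefficient_eq_sum (cov : AffineConnection E M) (c : E) {x : M} (hx : x ∈ e.baseSet) :
    (e ⟨x, cov (sectionOf e fun _ => c) x (sectionOf e (fun _ => c) x)⟩).2 =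
      ∑ i, ∑ j, (Module.finBasis ℝ E).repr c i • (Module.finBasis ℝ E).repr c j •
        (e ⟨x, cov (sectionOf e fun _ => Module.finBasis ℝ E i) x
          (sectionOf e (fun _ => Module.finBasis ℝ E j) x)⟩).2 := by
  set b := Module.finBasis ℝ E
  simp only [cov_sectionOf_const e cov _ hx, sectionOf]
  simp only [← e.continuousLinearMapAt_apply_of_mem (R := ℝ) hx]
  have key : ∀ L : E →ₗ[ℝ] E →ₗ[ℝ] E, L c c = ∑ i, ∑ j, b.repr c i • b.repr c j • L (b i) (b j) := by
    intro L
    calc L c c = L (∑ i, b.repr c i • b i) (∑ j, b.repr c j • b j) := by rw [b.sum_repr]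
      _ = _ := by
        simp only [map_sum, map_smul, LinearMap.sum_apply, LinearMap.smul_apply, Finset.smul_sum]
        rw [Finset.sum_comm]
        exact Finset.sum_congr rfl fun i _ => Finset.sum_congr rfl fun j _ => smul_comm _ _ _
  exact key (LinearMap.mk₂ ℝ (fun v w => e.continuousLinearMapAt ℝ x
    (connectionForm e cov x (e.symmL ℝ x v) (e.symmL ℝ x w)))
    (by intros; simp) (by intros; simp) (by intros; simp) (by intros; simp))

end

/-- The quadratic term of the geodesic equation in the chart at `x₀`. -/
def christoffel (cov : AffineConnection E M) (x₀ : M) (z : E × E) : E :=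
  let e := trivializationAt E (fun x : M => TangentSpace 𝓘(ℝ, E) x) x₀
  let y := (extChartAt 𝓘(ℝ, E) x₀).symm z.1
  (e ⟨y, cov (sectionOf e fun _ => z.2) y (sectionOf e (fun _ => z.2) y)⟩).2

/-- The geodesic vector field in the chart at `x₀`. -/
def spray (cov : AffineConnection E M) (x₀ : M) (z : E × E) : E × E :=
  (z.2, -christoffel cov x₀ z)

omit [FiniteDimensional ℝ E] in
lemma mem_baseSet_of_mem_source {x₀ y : M} (hy : y ∈ (extChartAt 𝓘(ℝ, E) x₀).source) :
    y ∈ (trivializationAt E (fun x : M => TangentSpace 𝓘(ℝ, E) x) x₀).baseSet := by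
  simpa using hy

lemma contDiffAt_christoffel [T2Space M] (cov : AffineConnection E M)
    [CovariantDerivative.ContMDiffCovariantDerivative cov ∞] {x₀ : M} {z : E × E}
    (hz : z.1 ∈ (extChartAt 𝓘(ℝ, E) x₀).target) : ContDiffAt ℝ ∞ (christoffel cov x₀) z := by
  set e := trivializationAt E (fun x : M => TangentSpace 𝓘(ℝ, E) x) x₀
  set φ := extChartAt 𝓘(ℝ, E) x₀ with hφ
  set b := Module.finBasis ℝ E
  have hb : ∀ i j, ContDiffAt ℝ ∞ (fun p : E × E => (e ⟨φ.symm p.1, cov (sectionOf e fun _ => b i)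
      (φ.symm p.1) (sectionOf e (fun _ => b j) (φ.symm p.1))⟩).2) z := by
    intro i j
    have h₁ : ContMDiffAt 𝓘(ℝ, E) 𝓘(ℝ, E) ∞ φ.symm z.1 :=
      (contMDiffOn_extChartAt_symm x₀).contMDiffAt
        ((isOpen_extChartAt_target x₀).mem_nhds hz)
    have h₂ := (contMDiffAt_coefficient e cov (b i) (b j)
      (mem_baseSet_of_mem_source (φ.map_target hz))).comp z.1 h₁
    exact h₂.contDiffAt.comp z contDiffAt_fst
  have hr : ∀ i, ContDiffAt ℝ ∞ (fun p : E × E => b.repr p.2 i) z := fun i =>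
    ((b.coord i).toContinuousLinearMap.contDiff.comp contDiff_snd).contDiffAt
  have hsum : ContDiffAt ℝ ∞ (fun p : E × E => ∑ i, ∑ j, b.repr p.2 i • b.repr p.2 j •
      (e ⟨φ.symm p.1, cov (sectionOf e fun _ => b i)
      (φ.symm p.1) (sectionOf e (fun _ => b j) (φ.symm p.1))⟩).2) z :=
    ContDiffAt.sum fun i _ => ContDiffAt.sum fun j _ => (hr i).smul ((hr j).smul (hb i j))
  refine hsum.congr_of_eventuallyEq ?_
  have : ∀ᶠ p : E × E in 𝓝 z, p.1 ∈ φ.target :=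
    continuousAt_fst.eventually ((isOpen_extChartAt_target x₀).mem_nhds hz)
  filter_upwards [this] with p hp
  exact coefficient_eq_sum e cov p.2 (mem_baseSet_of_mem_source (φ.map_target hp))

lemma contDiffAt_spray [T2Space M] (cov : AffineConnection E M)
    [CovariantDerivative.ContMDiffCovariantDerivative cov ∞] {x₀ : M} {z : E × E}
    (hz : z.1 ∈ (extChartAt 𝓘(ℝ, E) x₀).target) : ContDiffAt ℝ ∞ (spray cov x₀) z :=
  contDiffAt_snd.prodMk (contDiffAt_christoffel cov hz).neg

end Spray

/-! ### Geodesics as integral curves in a chart. -/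

section GeodesicEquation

variable {E : Type*} [NormedAddCommGroup E] [NormedSpace ℝ E]
  {M : Type*} [TopologicalSpace M] [ChartedSpace E M] [IsManifold 𝓘(ℝ, E) ∞ M]

/-- The position and velocity of a tangent vector in the chart at `x₀`. -/
def coords (x₀ : M) (v : TangentBundle 𝓘(ℝ, E) M) : E × E :=
  (extChartAt 𝓘(ℝ, E) x₀ v.proj,
    (trivializationAt E (fun x : M => TangentSpace 𝓘(ℝ, E) x) x₀ v).2)

/-- The tangent vector with given position and velocity in the chart at `x₀`. -/
def coordsSymm (x₀ : M) (z : E × E) : TangentBundle 𝓘(ℝ, E) M :=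
  ⟨(extChartAt 𝓘(ℝ, E) x₀).symm z.1, sectionOf
    (trivializationAt E (fun x : M => TangentSpace 𝓘(ℝ, E) x) x₀) (fun _ => z.2)
    ((extChartAt 𝓘(ℝ, E) x₀).symm z.1)⟩

lemma coordsSymm_coords {x₀ : M} {v : TangentBundle 𝓘(ℝ, E) M}
    (hv : v.proj ∈ (extChartAt 𝓘(ℝ, E) x₀).source) : coordsSymm x₀ (coords x₀ v) = v := by
  have h : ∀ y : M, y = v.proj → (⟨y, sectionOf
      (trivializationAt E (fun x : M => TangentSpace 𝓘(ℝ, E) x) x₀)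
      (fun _ => (coords x₀ v).2) y⟩ : TangentBundle 𝓘(ℝ, E) M) = v := by
    rintro y rfl
    have := symmL_trivialization (trivializationAt E (fun x : M => TangentSpace 𝓘(ℝ, E) x) x₀)
      (mem_baseSet_of_mem_source hv) v.snd
    exact congrArg (TotalSpace.mk v.proj) this
  exact h _ ((extChartAt 𝓘(ℝ, E) x₀).left_inv hv)

lemma continuousAt_coords {x₀ : M} {v : TangentBundle 𝓘(ℝ, E) M}
    (hv : v.proj ∈ (extChartAt 𝓘(ℝ, E) x₀).source) : ContinuousAt (coords x₀) v := by
  have h₁ : ContinuousAt (TotalSpace.proj : TangentBundle 𝓘(ℝ, E) M → M) v :=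
    (FiberBundle.continuous_proj E _).continuousAt
  have h₂ : ContinuousAt (trivializationAt E (fun x : M => TangentSpace 𝓘(ℝ, E) x) x₀) v :=
    OpenPartialHomeomorph.continuousAt
      (trivializationAt E (fun x : M => TangentSpace 𝓘(ℝ, E) x) x₀).toOpenPartialHomeomorph
      ((Trivialization.mem_source _).2 (mem_baseSet_of_mem_source hv))
  exact ((continuousAt_extChartAt' hv).comp h₁).prodMk h₂.snd

lemma continuousAt_coordsSymm {x₀ : M} {z : E × E}
    (hz : z.1 ∈ (extChartAt 𝓘(ℝ, E) x₀).target) : ContinuousAt (coordsSymm x₀) z := by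
  set e := trivializationAt E (fun x : M => TangentSpace 𝓘(ℝ, E) x) x₀
  set φ := extChartAt 𝓘(ℝ, E) x₀
  have hφ : ContinuousAt (fun p : E × E => φ.symm p.1) z :=
    ContinuousAt.comp (continuousAt_extChartAt_symm'' hz) continuousAt_fst
  have hb : φ.symm z.1 ∈ e.baseSet := mem_baseSet_of_mem_source (φ.map_target hz)
  have h : ContinuousAt (fun p : E × E => e.toOpenPartialHomeomorph.symm (φ.symm p.1, p.2)) z :=
    ContinuousAt.comp (f := fun p : E × E => (φ.symm p.1, p.2))
      (e.toOpenPartialHomeomorph.continuousAt_symm (e.mem_target.2 hb))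
      (hφ.prodMk continuousAt_snd)
  refine h.congr ?_
  filter_upwards [hφ (e.open_baseSet.mem_nhds hb)] with p hp
  rw [coordsSymm, sectionOf, e.symmL_apply hp, e.mk_symm hp]

/-- The trivialization of the tangent bundle at `x₀` is the derivative of the chart at `x₀`. -/
lemma hasDerivAt_extChartAt_comp {γ : ℝ → M} {x₀ : M} {t : ℝ}
    (ht : γ t ∈ (extChartAt 𝓘(ℝ, E) x₀).source)
    (hγ : MDifferentiableAt 𝓘(ℝ, ℝ) 𝓘(ℝ, E) γ t) :
    HasDerivAt (fun s => extChartAt 𝓘(ℝ, E) x₀ (γ s)) (coords x₀ (velocity γ t)).2 t := by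
  have ht' : γ t ∈ (chartAt E x₀).source := by simpa using ht
  convert! hasDerivAt_comp_curve (mdifferentiableAt_extChartAt ht') hγ using 1
  rw [mvfderiv, ← TangentBundle.continuousLinearMapAt_trivializationAt ht']
  exact (Trivialization.continuousLinearMapAt_apply_of_mem (R := ℝ) _
    (mem_baseSet_of_mem_source ht) _).symm

variable [FiniteDimensional ℝ E]

lemma hasDerivAt_coords_velocity {cov : AffineConnection E M} {γ : ℝ → M} {s : Set ℝ}
    (hγ : IsGeodesicOn cov γ s) {x₀ : M} {t : ℝ} (ht : t ∈ s)
    (hx : γ t ∈ (extChartAt 𝓘(ℝ, E) x₀).source) :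
    HasDerivAt (fun r => coords x₀ (velocity γ r)) (spray cov x₀ (coords x₀ (velocity γ t))) t := by
  set e := trivializationAt E (fun x : M => TangentSpace 𝓘(ℝ, E) x) x₀ with he
  set φ := extChartAt 𝓘(ℝ, E) x₀
  have hb : γ t ∈ e.baseSet := mem_baseSet_of_mem_source hx
  have h₁ := hasDerivAt_extChartAt_comp hx (hγ.mdifferentiableAt t ht)
  have h₂ := (differentiableAt_components e (c := velocity γ) hb
    (hγ.mdifferentiableAt_velocity t ht)).hasDerivAt
  refine h₁.prodMk ?_
  convert! h₂ using 1
  -- `covDerivAlong` is defined in the trivialization at the moving point `γ t`; here the equation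
  -- is transferred to the fixed one at `x₀`.
  have h₃ := (covDerivAlong_eq e cov (γ := γ) (V := fun r => (velocity γ r).snd) hb
    (hγ.mdifferentiableAt t ht) (hγ.mdifferentiableAt_velocity t ht)).symm.trans
    (hγ.acceleration_eq_zero t ht)
  have h₄ := congrArg (e.continuousLinearMapAt ℝ (γ t)) h₃
  rw [map_add, e.continuousLinearMapAt_symmL hb, map_zero,
    e.continuousLinearMapAt_apply_of_mem (R := ℝ) hb] at h₄
  have h₅ : mfderiv 𝓘(ℝ, ℝ) 𝓘(ℝ, E) γ t (1 : ℝ) =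
      sectionOf e (fun _ => (coords x₀ (velocity γ t)).2) (γ t) :=
    (symmL_trivialization e hb _).symm
  have h₆ : christoffel cov x₀ (coords x₀ (velocity γ t)) = (e ⟨γ t,
      cov (sectionOf e fun _ => (coords x₀ (velocity γ t)).2) (γ t)
        (mfderiv 𝓘(ℝ, ℝ) 𝓘(ℝ, E) γ t (1 : ℝ))⟩).2 := by
    rw [h₅]
    exact congrArg (fun y => (e ⟨y, cov (sectionOf e fun _ => (coords x₀ (velocity γ t)).2) y
      (sectionOf e (fun _ => (coords x₀ (velocity γ t)).2) y)⟩).2) (φ.left_inv hx)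
  rw [h₆]
  exact (eq_neg_of_add_eq_zero_left h₄).symm

/-- A solution of the geodesic equation in a chart is a geodesic. -/
lemma isGeodesicOn_of_hasDerivAt {cov : AffineConnection E M} {x₀ : M} {c : ℝ → E × E} {s : Set ℝ}
    (hs : IsOpen s) (hs' : s.OrdConnected)
    (hc : ∀ t ∈ s, HasDerivAt c (spray cov x₀ (c t)) t ∧
      (c t).1 ∈ (extChartAt 𝓘(ℝ, E) x₀).target) :
    IsGeodesicOn cov (fun t => (extChartAt 𝓘(ℝ, E) x₀).symm (c t).1) s ∧
      ∀ t ∈ s, velocity (fun t => (extChartAt 𝓘(ℝ, E) x₀).symm (c t).1) t =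
        coordsSymm x₀ (c t) := by
  set e := trivializationAt E (fun x : M => TangentSpace 𝓘(ℝ, E) x) x₀ with he
  set φ := extChartAt 𝓘(ℝ, E) x₀ with hφ
  set γ : ℝ → M := fun t => φ.symm (c t).1 with hγ
  have hsrc : ∀ t ∈ s, γ t ∈ φ.source := fun t ht => φ.map_target (hc t ht).2
  have hmd : ∀ t ∈ s, MDifferentiableAt 𝓘(ℝ, ℝ) 𝓘(ℝ, E) γ t := by
    intro t ht
    have h₁ : MDifferentiableAt 𝓘(ℝ, E) 𝓘(ℝ, E) φ.symm (c t).1 :=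
      ((contMDiffOn_extChartAt_symm (n := 1) x₀).contMDiffAt
        ((isOpen_extChartAt_target x₀).mem_nhds (hc t ht).2)).mdifferentiableAt one_ne_zero
    have h₂ : DifferentiableAt ℝ (fun r => (c r).1) t := (hc t ht).1.differentiableAt.fst
    exact h₁.comp t h₂.mdifferentiableAt
  have hcoords : ∀ t ∈ s, coords x₀ (velocity γ t) = c t := by
    intro t ht
    have h₁ : (fun r => φ (γ r)) =ᶠ[𝓝 t] fun r => (c r).1 := by
      filter_upwards [hs.mem_nhds ht] with r hr using φ.right_inv (hc r hr).2
    have h₂ := (hasDerivAt_extChartAt_comp (hsrc t ht) (hmd t ht)).congr_of_eventuallyEq h₁.symm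
    have h₃ : HasDerivAt (fun r => (c r).1) (c t).2 t := by
      simpa [spray] using (hc t ht).1.hasFDerivAt.fst.hasDerivAt
    exact Prod.ext (φ.right_inv (hc t ht).2) (h₂.unique h₃)
  have hvel : ∀ t ∈ s, velocity γ t = coordsSymm x₀ (c t) := by
    intro t ht
    rw [← hcoords t ht]
    exact (coordsSymm_coords (hsrc t ht)).symm
  have hcomp : ∀ t ∈ s, (fun r => (e (velocity γ r)).2) =ᶠ[𝓝 t] fun r => (c r).2 := by
    intro t ht
    filter_upwards [hs.mem_nhds ht] with r hr using congrArg Prod.snd (hcoords r hr)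
  have hcomp' : ∀ t ∈ s, HasDerivAt (fun r => (e (velocity γ r)).2)
      (-christoffel cov x₀ (c t)) t := by
    intro t ht
    have h : HasDerivAt (fun r => (c r).2) (-christoffel cov x₀ (c t)) t := by
      simpa [spray] using (hc t ht).1.hasFDerivAt.snd.hasDerivAt
    exact h.congr_of_eventuallyEq (hcomp t ht)
  have hvmd : ∀ t ∈ s, MDifferentiableAt 𝓘(ℝ, ℝ) 𝓘(ℝ, E).tangent (velocity (E := E) γ) t := by
    intro t ht
    refine (e.mdifferentiableAt_totalSpace_iff 𝓘(ℝ, E) _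
      (e.mem_source.mpr (mem_baseSet_of_mem_source (hsrc t ht)))).2
      ⟨hmd t ht, (hcomp' t ht).differentiableAt.mdifferentiableAt⟩
  refine ⟨⟨hs, hs', hmd, hvmd, fun t ht => ?_⟩, hvel⟩
  have hb : γ t ∈ e.baseSet := mem_baseSet_of_mem_source (hsrc t ht)
  refine (covDerivAlong_eq e cov (γ := γ) (V := fun r => (velocity γ r).snd) hb (hmd t ht)
    (hvmd t ht)).trans ?_
  have h₁ : deriv (fun r => (e ⟨γ r, (velocity (E := E) γ r).snd⟩).2) t =
      -christoffel cov x₀ (c t) := (hcomp' t ht).deriv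
  have h₂ : (e ⟨γ t, (velocity (E := E) γ t).snd⟩).2 = (c t).2 := (hcomp t ht).self_of_nhds
  have h₃ : mfderiv 𝓘(ℝ, ℝ) 𝓘(ℝ, E) γ t (1 : ℝ) = sectionOf e (fun _ => (c t).2) (γ t) := by
    rw [← h₂]
    exact (symmL_trivialization e hb _).symm
  rw [h₁, h₂, h₃, map_neg]
  have h₄ : e.symmL ℝ (γ t) (christoffel cov x₀ (c t)) =
      cov (sectionOf e fun _ => (c t).2) (γ t) (sectionOf e (fun _ => (c t).2) (γ t)) :=
    symmL_trivialization e hb _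
  rw [h₄, neg_add_cancel]

end GeodesicEquation

/-- A `C¹` vector field has a local flow with values in a prescribed neighbourhood, which depends
continuously on the initial value. -/
lemma exists_local_flow {F : Type*} [NormedAddCommGroup F] [NormedSpace ℝ F] [CompleteSpace F]
    {f : F → F} {z₀ : F} (hf : ContDiffAt ℝ 1 f z₀) {U : Set F} (hU : U ∈ 𝓝 z₀) :
    ∃ ε > 0, ∃ N ∈ 𝓝 z₀, ∃ α : F → ℝ → F, ∀ z ∈ N, α z 0 = z ∧
      ∀ t ∈ Ioo (-ε) ε, HasDerivAt (α z) (f (α z t)) t ∧ α z t ∈ U ∧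
        ContinuousAt (fun z => α z t) z := by
  obtain ⟨ε, hε, a, r, L, K, hr, hpl⟩ := IsPicardLindelof.of_contDiffAt_one hf
  obtain ⟨α, hα, hcont⟩ :=
    (hpl 0).exists_forall_mem_closedBall_eq_hasDerivWithinAt_continuousOn
  simp only [zero_sub, zero_add] at hα hcont
  have hr' : (0 : ℝ) < r := hr
  have hmem : Metric.closedBall z₀ (r : ℝ) ×ˢ Icc (-ε) ε ∈ 𝓝 (z₀, (0 : ℝ)) :=
    prod_mem_nhds (Metric.closedBall_mem_nhds z₀ hr') (Icc_mem_nhds (by linarith) hε)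
  have hc₀ : ContinuousAt α (z₀, 0) := hcont.continuousAt hmem
  -- Joint continuity at `(z₀, 0)` lets both the ball and the time interval shrink until the flow
  -- stays in `U`.
  have hU' : α ⁻¹' U ∈ 𝓝 (z₀, (0 : ℝ)) := by
    apply hc₀
    rwa [(hα z₀ (Metric.mem_closedBall_self hr'.le)).1]
  obtain ⟨N, hN, T, hT, hNT⟩ := mem_nhds_prod_iff.1 hU'
  obtain ⟨δ, hδ, hδT⟩ := Metric.mem_nhds_iff.1 hT
  refine ⟨min ε δ, lt_min hε hδ, Metric.ball z₀ r ∩ N,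
    inter_mem (Metric.ball_mem_nhds z₀ hr') hN, fun z t => α (z, t), fun z hz => ?_⟩
  have hz' := Metric.ball_subset_closedBall hz.1
  refine ⟨(hα z hz').1, fun t ht => ?_⟩
  have ht₁ : t ∈ Ioo (-ε) ε :=
    ⟨by have := ht.1; have := min_le_left ε δ; linarith, ht.2.trans_le (min_le_left _ _)⟩
  have ht₂ : t ∈ Metric.ball (0 : ℝ) δ := by
    rw [Real.ball_eq_Ioo]
    exact ⟨by have := ht.1; have := min_le_right ε δ; linarith,
      by have := ht.2.trans_le (min_le_right ε δ); linarith⟩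
  refine ⟨((hα z hz').2 t (Ioo_subset_Icc_self ht₁)).hasDerivAt (Icc_mem_nhds ht₁.1 ht₁.2),
    hNT (mk_mem_prod hz.2 (hδT ht₂)), ?_⟩
  have : ContinuousAt α (z, t) := hcont.continuousAt
    (prod_mem_nhds (mem_of_superset (Metric.isOpen_ball.mem_nhds hz.1)
      Metric.ball_subset_closedBall) (Icc_mem_nhds ht₁.1 ht₁.2))
  exact this.comp (f := fun z => (z, t)) (by fun_prop)

/-! ### Local existence and uniqueness of geodesics. -/

section LocalFlow

variable {E : Type*} [NormedAddCommGroup E] [NormedSpace ℝ E] [FiniteDimensional ℝ E]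
  {M : Type*} [TopologicalSpace M] [ChartedSpace E M] [IsManifold 𝓘(ℝ, E) ∞ M] [T2Space M]
  (cov : AffineConnection E M) [CovariantDerivative.ContMDiffCovariantDerivative cov ∞]

/-- Local existence of geodesics, with continuous dependence on the initial velocity. -/
theorem exists_local_geodesic_flow (v₀ : TangentBundle 𝓘(ℝ, E) M) :
    ∃ ε > 0, ∃ N ∈ 𝓝 v₀, ∃ g : TangentBundle 𝓘(ℝ, E) M → ℝ → M, ∀ v ∈ N,
      IsGeodesicOn cov (g v) (Ioo (-ε) ε) ∧ velocity (g v) 0 = v ∧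
        ∀ t ∈ Ioo (-ε) ε, ContinuousAt (fun v => velocity (E := E) (g v) t) v := by
  set x₀ := v₀.proj
  have hx₀ : v₀.proj ∈ (extChartAt 𝓘(ℝ, E) x₀).source := mem_extChartAt_source x₀
  have htgt : (coords x₀ v₀).1 ∈ (extChartAt 𝓘(ℝ, E) x₀).target :=
    (extChartAt 𝓘(ℝ, E) x₀).map_source hx₀
  have hU : Prod.fst ⁻¹' (extChartAt 𝓘(ℝ, E) x₀).target ∈ 𝓝 (coords x₀ v₀) :=
    continuousAt_fst ((isOpen_extChartAt_target x₀).mem_nhds htgt)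
  obtain ⟨ε, hε, N, hN, α, hα⟩ :=
    exists_local_flow ((contDiffAt_spray cov htgt).of_le (by norm_cast)) hU
  have hsrc : TotalSpace.proj ⁻¹' (extChartAt 𝓘(ℝ, E) x₀).source ∈ 𝓝 v₀ :=
    (FiberBundle.continuous_proj E _).continuousAt
      ((isOpen_extChartAt_source x₀).mem_nhds hx₀)
  -- The interior is taken because continuity at `v` requires the formula for the velocity at all
  -- vectors near `v`.
  refine ⟨ε, hε, interior (coords x₀ ⁻¹' N ∩
    TotalSpace.proj ⁻¹' (extChartAt 𝓘(ℝ, E) x₀).source), interior_mem_nhds.2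
    (inter_mem (continuousAt_coords hx₀ hN) hsrc),
    fun v t => (extChartAt 𝓘(ℝ, E) x₀).symm (α (coords x₀ v) t).1, fun v hv => ?_⟩
  have key : ∀ w ∈ coords x₀ ⁻¹' N ∩ TotalSpace.proj ⁻¹' (extChartAt 𝓘(ℝ, E) x₀).source, _ :=
    fun w hw => isGeodesicOn_of_hasDerivAt (cov := cov) (x₀ := x₀) (c := α (coords x₀ w))
      (isOpen_Ioo (a := -ε) (b := ε)) ordConnected_Ioo
      fun t ht => ⟨((hα _ hw.1).2 t ht).1, ((hα _ hw.1).2 t ht).2.1⟩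
  have hv' := interior_subset hv
  refine ⟨(key v hv').1, ?_, fun t ht => ?_⟩
  · rw [(key v hv').2 0 (by simpa using hε), (hα _ hv'.1).1, coordsSymm_coords hv'.2]
  · have h₁ : ContinuousAt (fun w => coordsSymm x₀ (α (coords x₀ w) t)) v :=
      ContinuousAt.comp (g := coordsSymm x₀)
        (continuousAt_coordsSymm ((hα _ hv'.1).2 t ht).2.1)
        (ContinuousAt.comp (g := fun z => α z t) ((hα _ hv'.1).2 t ht).2.2
          (continuousAt_coords hv'.2))
    refine h₁.congr ?_
    filter_upwards [mem_interior_iff_mem_nhds.1 hv] with w hw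
    exact ((key w hw).2 t ht).symm

variable {cov}

/-- Local uniqueness of geodesics. -/
theorem velocity_eventuallyEq {γ₁ γ₂ : ℝ → M} {s₁ s₂ : Set ℝ} (h₁ : IsGeodesicOn cov γ₁ s₁)
    (h₂ : IsGeodesicOn cov γ₂ s₂) {t : ℝ} (ht₁ : t ∈ s₁) (ht₂ : t ∈ s₂)
    (h : velocity (E := E) γ₁ t = velocity γ₂ t) :
    velocity (E := E) γ₁ =ᶠ[𝓝 t] velocity γ₂ := by
  set x₀ := γ₁ t
  have hx : γ₁ t ∈ (extChartAt 𝓘(ℝ, E) x₀).source := mem_extChartAt_source x₀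
  have hx' : γ₂ t ∈ (extChartAt 𝓘(ℝ, E) x₀).source := by
    have : γ₁ t = γ₂ t := congrArg TotalSpace.proj h
    rwa [← this]
  have htgt : (coords x₀ (velocity (E := E) γ₁ t)).1 ∈ (extChartAt 𝓘(ℝ, E) x₀).target :=
    (extChartAt 𝓘(ℝ, E) x₀).map_source hx
  have hC : ContDiffAt ℝ 1 (spray cov x₀) (coords x₀ (velocity (E := E) γ₁ t)) :=
    (contDiffAt_spray cov htgt).of_le (by norm_cast)
  obtain ⟨K, S, hS, hK⟩ := hC.exists_lipschitzOnWith
  have key : ∀ {γ : ℝ → M} {s : Set ℝ}, IsGeodesicOn cov γ s → t ∈ s →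
      γ t ∈ (extChartAt 𝓘(ℝ, E) x₀).source → S ∈ 𝓝 (coords x₀ (velocity (E := E) γ t)) →
      ∀ᶠ r in 𝓝 t, γ r ∈ (extChartAt 𝓘(ℝ, E) x₀).source ∧
        HasDerivAt (fun r => coords x₀ (velocity γ r))
          (spray cov x₀ (coords x₀ (velocity γ r))) r ∧ coords x₀ (velocity (E := E) γ r) ∈ S := by
    intro γ s hγ hts hsrc hS'
    filter_upwards [hγ.isOpen.mem_nhds hts, (hγ.mdifferentiableAt t hts).continuousAt
      ((isOpen_extChartAt_source x₀).mem_nhds hsrc),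
      (hasDerivAt_coords_velocity hγ hts hsrc).continuousAt hS'] with r hr hr' hr''
    exact ⟨hr', hasDerivAt_coords_velocity hγ hr hr', hr''⟩
  have k₁ := key h₁ ht₁ hx hS
  have k₂ := key h₂ ht₂ hx' (by rwa [← h])
  have := ODE_solution_unique_of_eventually (v := fun _ => spray cov x₀) (s := fun _ => S)
    (Eventually.of_forall fun _ => hK) (k₁.mono fun r hr => hr.2) (k₂.mono fun r hr => hr.2)
    (congrArg (coords x₀) h)
  filter_upwards [this, k₁, k₂] with r hr hr₁ hr₂
  rw [← coordsSymm_coords (x₀ := x₀) (v := velocity γ₁ r) hr₁.1,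
    ← coordsSymm_coords (x₀ := x₀) (v := velocity γ₂ r) hr₂.1]
  exact congrArg _ hr

end LocalFlow

/-! ### Locality and affine reparametrization of geodesics. -/

section Geodesics

variable {E : Type*} [NormedAddCommGroup E] [NormedSpace ℝ E]
  {M : Type*} [TopologicalSpace M] [ChartedSpace E M] [IsManifold 𝓘(ℝ, E) ∞ M]

/-- Points without disjoint neighbourhoods have the same projection, as `M` is Hausdorff; they then
lie in one trivialization, whose target is Hausdorff. -/
instance t2Space_tangentBundle [T2Space M] : T2Space (TangentBundle 𝓘(ℝ, E) M) := by
  refine t2_iff_nhds.2 fun {v w} hvw => ?_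
  have hp : Continuous (TotalSpace.proj : TangentBundle 𝓘(ℝ, E) M → M) :=
    FiberBundle.continuous_proj E _
  have h₁ : v.proj = w.proj := tendsto_nhds_unique (l := 𝓝 v ⊓ 𝓝 w)
    ((hp.tendsto v).mono_left inf_le_left) ((hp.tendsto w).mono_left inf_le_right)
  set e := trivializationAt E (fun x : M => TangentSpace 𝓘(ℝ, E) x) v.proj
  have hv : v ∈ e.source := e.mem_source.2 (mem_baseSet_trivializationAt _ _ _)
  have hw : w ∈ e.source :=
    e.mem_source.2 (by rw [← h₁]; exact mem_baseSet_trivializationAt _ _ _)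
  refine e.injOn hv hw (tendsto_nhds_unique (l := 𝓝 v ⊓ 𝓝 w)
    ((e.toOpenPartialHomeomorph.continuousAt hv).mono_left inf_le_left)
    ((e.toOpenPartialHomeomorph.continuousAt hw).mono_left inf_le_right))

omit [IsManifold 𝓘(ℝ, E) ∞ M] in
lemma velocity_eq_of_eventuallyEq {γ γ' : ℝ → M} {t : ℝ} (h : γ =ᶠ[𝓝 t] γ') :
    velocity (E := E) γ t = velocity γ' t :=
  TotalSpace.ext h.self_of_nhds (heq_of_eq (congrArg (fun L : ℝ →L[ℝ] E => L 1) h.mfderiv_eq))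

/-- The acceleration of a curve in terms of its velocity `v` and the derivative `a` of the
components of its velocity. -/
def accel (cov : AffineConnection E M) (v : TangentBundle 𝓘(ℝ, E) M) (a : E) :
    TangentSpace 𝓘(ℝ, E) v.proj :=
  let e := trivializationAt E (fun x : M => TangentSpace 𝓘(ℝ, E) x) v.proj
  e.symmL ℝ v.proj a + cov (sectionOf e fun _ => (e v).2) v.proj v.snd

lemma covDerivAlong_velocity (cov : AffineConnection E M) (γ : ℝ → M) (t : ℝ) :
    covDerivAlong cov γ (fun r => (velocity (E := E) γ r).snd) t =
      accel cov (velocity γ t) (deriv (fun r => (trivializationAt E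
        (fun x : M => TangentSpace 𝓘(ℝ, E) x) (velocity (E := E) γ t).proj (velocity γ r)).2) t) :=
  rfl

lemma IsGeodesicOn.congr {cov : AffineConnection E M} {γ γ' : ℝ → M} {s : Set ℝ}
    (h : IsGeodesicOn cov γ s) (he : EqOn γ γ' s) : IsGeodesicOn cov γ' s := by
  have hev : ∀ t ∈ s, γ =ᶠ[𝓝 t] γ' := fun t ht => he.eventuallyEq_of_mem (h.isOpen.mem_nhds ht)
  have hvel : ∀ t ∈ s, velocity (E := E) γ =ᶠ[𝓝 t] velocity γ' := fun t ht =>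
    (hev t ht).eventuallyEq_nhds.mono fun r hr => velocity_eq_of_eventuallyEq hr
  refine ⟨h.isOpen, h.ordConnected, fun t ht =>
    (h.mdifferentiableAt t ht).congr_of_eventuallyEq (hev t ht).symm, fun t ht =>
    (h.mdifferentiableAt_velocity t ht).congr_of_eventuallyEq (hvel t ht).symm, fun t ht => ?_⟩
  have h₀ := h.acceleration_eq_zero t ht
  rw [covDerivAlong_velocity] at h₀ ⊢
  -- The acceleration takes values in a tangent space that depends on the velocity, so the equality
  -- of velocities is used by substituting a variable.
  have key : ∀ v w : TangentBundle 𝓘(ℝ, E) M, v = w →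
      accel cov v (deriv (fun r => (trivializationAt E
        (fun x : M => TangentSpace 𝓘(ℝ, E) x) v.proj (velocity γ r)).2) t) = 0 →
      accel cov w (deriv (fun r => (trivializationAt E
        (fun x : M => TangentSpace 𝓘(ℝ, E) x) w.proj (velocity γ' r)).2) t) = 0 := by
    rintro v _ rfl hv
    have hd := ((hvel t ht).fun_comp fun z => (trivializationAt E
      (fun x : M => TangentSpace 𝓘(ℝ, E) x) v.proj z).2).deriv_eq
    exact (congrArg (accel cov v) hd).symm.trans hv
  exact key _ _ (hvel t ht).self_of_nhds h₀

lemma IsGeodesicOn.velocity_eq {cov : AffineConnection E M} {γ γ' : ℝ → M} {s : Set ℝ}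
    (h : IsGeodesicOn cov γ s) (he : EqOn γ γ' s) {t : ℝ} (ht : t ∈ s) :
    velocity (E := E) γ t = velocity γ' t :=
  velocity_eq_of_eventuallyEq (he.eventuallyEq_of_mem (h.isOpen.mem_nhds ht))

lemma IsGeodesicOn.continuousAt_velocity {cov : AffineConnection E M} {γ : ℝ → M} {s : Set ℝ}
    (h : IsGeodesicOn cov γ s) {t : ℝ} (ht : t ∈ s) : ContinuousAt (velocity (E := E) γ) t :=
  (h.mdifferentiableAt_velocity t ht).continuousAt

lemma IsGeodesicOn.mono {cov : AffineConnection E M} {γ : ℝ → M} {s s' : Set ℝ}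
    (h : IsGeodesicOn cov γ s) (hs : s' ⊆ s) (ho : IsOpen s') (hc : s'.OrdConnected) :
    IsGeodesicOn cov γ s' :=
  ⟨ho, hc, fun t ht => h.mdifferentiableAt t (hs ht),
    fun t ht => h.mdifferentiableAt_velocity t (hs ht),
    fun t ht => h.acceleration_eq_zero t (hs ht)⟩

/-- Being a geodesic is a local property. -/
lemma isGeodesicOn_of_forall_mem {cov : AffineConnection E M} {γ : ℝ → M} {s : Set ℝ}
    (hs : s.OrdConnected) (h : ∀ t ∈ s, ∃ s' ⊆ s, t ∈ s' ∧ IsGeodesicOn cov γ s') :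
    IsGeodesicOn cov γ s := by
  refine ⟨isOpen_iff_mem_nhds.2 fun t ht => ?_, hs, fun t ht => ?_, fun t ht => ?_, fun t ht => ?_⟩
  all_goals obtain ⟨s', hs', hts', hg⟩ := h t ht
  · exact mem_of_superset (hg.isOpen.mem_nhds hts') hs'
  · exact hg.mdifferentiableAt t hts'
  · exact hg.mdifferentiableAt_velocity t hts'
  · exact hg.acceleration_eq_zero t hts'

/-! ### Affine reparametrization -/

omit [IsManifold 𝓘(ℝ, E) ∞ M] in
lemma velocity_comp_affine {γ : ℝ → M} {a b t : ℝ}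
    (hγ : MDifferentiableAt 𝓘(ℝ, ℝ) 𝓘(ℝ, E) γ (a * t + b)) :
    velocity (E := E) (fun r => γ (a * r + b)) t = scale a (velocity γ (a * t + b)) := by
  have hL : HasDerivAt (fun r : ℝ => a * r + b) a t := by
    simpa using ((hasDerivAt_id t).const_mul a).add_const b
  have h := hγ.hasMFDerivAt.comp t hL.hasFDerivAt.hasMFDerivAt
  have h' : mfderiv 𝓘(ℝ, ℝ) 𝓘(ℝ, E) (fun r => γ (a * r + b)) t (1 : ℝ) =
      mfderiv 𝓘(ℝ, ℝ) 𝓘(ℝ, E) γ (a * t + b) ((1 : ℝ) • a) :=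
    congrArg (fun L : ℝ →L[ℝ] E => L 1) h.mfderiv
  have h'' : mfderiv 𝓘(ℝ, ℝ) 𝓘(ℝ, E) γ (a * t + b) ((1 : ℝ) • a) =
      a • mfderiv 𝓘(ℝ, ℝ) 𝓘(ℝ, E) γ (a * t + b) (1 : ℝ) := by
    have := (mfderiv 𝓘(ℝ, ℝ) 𝓘(ℝ, E) γ (a * t + b)).map_smul a (1 : ℝ)
    rw [← this]
    congr 1
    exact (one_mul a).trans (mul_one a).symm
  exact congrArg (TotalSpace.mk (γ (a * t + b))) (h'.trans h'')

omit [IsManifold 𝓘(ℝ, E) ∞ M] in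
@[simp] lemma scale_proj (a : ℝ) (v : TangentBundle 𝓘(ℝ, E) M) : (scale a v).proj = v.proj := rfl

omit [IsManifold 𝓘(ℝ, E) ∞ M] in
@[simp] lemma scale_snd (a : ℝ) (v : TangentBundle 𝓘(ℝ, E) M) : (scale a v).snd = a • v.snd := rfl

omit [IsManifold 𝓘(ℝ, E) ∞ M] in
lemma scale_scale (a b : ℝ) (v : TangentBundle 𝓘(ℝ, E) M) :
    scale a (scale b v) = scale (a * b) v :=
  congrArg (TotalSpace.mk v.proj) (smul_smul a b v.snd)

omit [IsManifold 𝓘(ℝ, E) ∞ M] in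
@[simp] lemma scale_one (v : TangentBundle 𝓘(ℝ, E) M) : scale 1 v = v :=
  congrArg (TotalSpace.mk v.proj) (one_smul ℝ v.snd)

section

variable (e : Trivialization E (TotalSpace.proj : TangentBundle 𝓘(ℝ, E) M → M))
  [MemTrivializationAtlas e]

lemma trivialization_scale (a : ℝ) {v : TangentBundle 𝓘(ℝ, E) M} (hv : v.proj ∈ e.baseSet) :
    (e (scale a v)).2 = a • (e v).2 :=
  (e.linear ℝ hv).map_smul a v.snd

end

lemma continuous_scale :
    Continuous fun p : ℝ × TangentBundle 𝓘(ℝ, E) M => scale p.1 p.2 := by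
  refine continuous_iff_continuousAt.2 fun p => ?_
  set e := trivializationAt E (fun x : M => TangentSpace 𝓘(ℝ, E) x) p.2.proj
  have hp : Continuous (TotalSpace.proj : TangentBundle 𝓘(ℝ, E) M → M) :=
    FiberBundle.continuous_proj E _
  have hb : p.2.proj ∈ e.baseSet := mem_baseSet_trivializationAt _ _ _
  rw [FiberBundle.continuousAt_totalSpace]
  refine ⟨(hp.comp continuous_snd).continuousAt, ?_⟩
  have h₁ : ContinuousAt (fun q : ℝ × TangentBundle 𝓘(ℝ, E) M => q.1 • (e q.2).2) p :=
    continuousAt_fst.smul (ContinuousAt.comp (g := fun v => (e v).2)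
      (e.toOpenPartialHomeomorph.continuousAt (e.mem_source.2 hb)).snd continuousAt_snd)
  refine h₁.congr ?_
  filter_upwards [(hp.comp continuous_snd).continuousAt (e.open_baseSet.mem_nhds hb)] with q hq
  exact (trivialization_scale e q.1 hq).symm

variable [FiniteDimensional ℝ E]

/-- The connection term is quadratic in the velocity. This homogeneity is why affine changes of
parameter preserve geodesics. -/
lemma accel_scale (cov : AffineConnection E M) (v : TangentBundle 𝓘(ℝ, E) M) (a : E) (r : ℝ) :
    accel cov (scale r v) ((r * r) • a) = (r * r) • accel cov v a := by
  set e := trivializationAt E (fun x : M => TangentSpace 𝓘(ℝ, E) x) v.proj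
  have hb : v.proj ∈ e.baseSet := mem_baseSet_trivializationAt _ _ _
  have h₁ : accel cov (scale r v) ((r * r) • a) = e.symmL ℝ v.proj ((r * r) • a) +
      cov (sectionOf e fun _ => (e (scale r v)).2) v.proj (r • v.snd) := rfl
  have h₂ : accel cov v a = e.symmL ℝ v.proj a +
      cov (sectionOf e fun _ => (e v).2) v.proj v.snd := rfl
  rw [h₁, h₂, trivialization_scale e r hb, cov_sectionOf_const e cov _ hb,
    cov_sectionOf_const e cov _ hb]
  simp [smul_smul]

/-- The velocity is multiplied by `a` and the derivative of its components by `a * a`. The case `a =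
0`, a constant curve, is included. -/
lemma IsGeodesicOn.comp_affine {cov : AffineConnection E M} {γ : ℝ → M} {s : Set ℝ}
    (h : IsGeodesicOn cov γ s) (a b : ℝ) :
    IsGeodesicOn cov (fun r => γ (a * r + b)) ((fun r => a * r + b) ⁻¹' s) := by
  have hcont : Continuous fun r : ℝ => a * r + b := by fun_prop
  have hvel : ∀ t, a * t + b ∈ s → velocity (E := E) (fun r => γ (a * r + b)) =ᶠ[𝓝 t]
      fun r => scale a (velocity γ (a * r + b)) := by
    intro t ht
    filter_upwards [(h.isOpen.preimage hcont).mem_nhds ht] with r hr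
    exact velocity_comp_affine (h.mdifferentiableAt _ hr)
  have hL : ∀ t : ℝ, HasDerivAt (fun r : ℝ => a * r + b) a t := fun t => by
    simpa using ((hasDerivAt_id t).const_mul a).add_const b
  have hcomp : ∀ t (ht : a * t + b ∈ s), HasDerivAt (fun r => (trivializationAt E
      (fun x : M => TangentSpace 𝓘(ℝ, E) x) (γ (a * t + b))
        (velocity (fun r => γ (a * r + b)) r)).2)
      ((a * a) • deriv (fun r => (trivializationAt E
      (fun x : M => TangentSpace 𝓘(ℝ, E) x) (γ (a * t + b)) (velocity γ r)).2) (a * t + b)) t := by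
    intro t ht
    set e := trivializationAt E (fun x : M => TangentSpace 𝓘(ℝ, E) x) (γ (a * t + b))
    have hb : γ (a * t + b) ∈ e.baseSet := mem_baseSet_trivializationAt _ _ _
    have h₁ := (differentiableAt_components e (c := velocity γ) hb
      (h.mdifferentiableAt_velocity _ ht)).hasDerivAt
    have h₂ := (h₁.scomp t (hL t)).const_smul a
    rw [smul_smul] at h₂
    refine h₂.congr_of_eventuallyEq ?_
    have hnear : ∀ᶠ r in 𝓝 t, γ (a * r + b) ∈ e.baseSet :=
      ContinuousAt.comp (g := γ) (f := fun r : ℝ => a * r + b)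
        (h.mdifferentiableAt _ ht).continuousAt hcont.continuousAt
        (e.open_baseSet.mem_nhds hb)
    filter_upwards [hvel t ht, hnear] with r hr hr'
    rw [hr, trivialization_scale e a (v := velocity γ (a * r + b)) hr']
    rfl
  have hmd : ∀ t, a * t + b ∈ s →
      MDifferentiableAt 𝓘(ℝ, ℝ) 𝓘(ℝ, E) (fun r => γ (a * r + b)) t := fun t ht =>
    MDifferentiableAt.comp (g := γ) t (h.mdifferentiableAt _ ht)
      (hL t).differentiableAt.mdifferentiableAt
  refine ⟨h.isOpen.preimage hcont, ?_, hmd, fun t ht => ?_, fun t ht => ?_⟩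
  · refine ⟨fun x hx y hy z hz => ?_⟩
    rcases le_total 0 a with ha | ha
    · exact h.ordConnected.out hx hy
        ⟨by have := mul_le_mul_of_nonneg_left hz.1 ha; simpa using this,
          by have := mul_le_mul_of_nonneg_left hz.2 ha; simpa using this⟩
    · exact h.ordConnected.out hy hx
        ⟨by have := mul_le_mul_of_nonpos_left hz.2 ha; simpa using this,
          by have := mul_le_mul_of_nonpos_left hz.1 ha; simpa using this⟩
  · rw [mdifferentiableAt_totalSpace]
    exact ⟨hmd t ht, (hcomp t ht).differentiableAt.mdifferentiableAt⟩
  · rw [covDerivAlong_velocity]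
    have h₁ := (hcomp t ht).deriv
    have key : ∀ v : TangentBundle 𝓘(ℝ, E) M, v = scale a (velocity γ (a * t + b)) →
        accel cov v (deriv (fun r => (trivializationAt E (fun x : M => TangentSpace 𝓘(ℝ, E) x)
          (γ (a * t + b)) (velocity (fun r => γ (a * r + b)) r)).2) t) = 0 := by
      rintro _ rfl
      rw [h₁, accel_scale]
      have h₂ := h.acceleration_eq_zero _ ht
      rw [covDerivAlong_velocity] at h₂
      exact (congrArg (fun z => (a * a) • z) h₂).trans
        (smul_zero (A := TangentSpace 𝓘(ℝ, E) (γ (a * t + b))) (a * a))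
    exact key _ (hvel t ht).self_of_nhds

end Geodesics

/-! ### Global uniqueness, the geodesic flow and the exponential map. -/

section Exponential

variable {E : Type*} [NormedAddCommGroup E] [NormedSpace ℝ E] [FiniteDimensional ℝ E]
  {M : Type*} [TopologicalSpace M] [ChartedSpace E M] [IsManifold 𝓘(ℝ, E) ∞ M] [T2Space M]
  {cov : AffineConnection E M} [CovariantDerivative.ContMDiffCovariantDerivative cov ∞]

/-- Two geodesics with the same velocity at one time agree on their common domain. -/
theorem IsGeodesicOn.eqOn_velocity {γ₁ γ₂ : ℝ → M} {s₁ s₂ : Set ℝ} (h₁ : IsGeodesicOn cov γ₁ s₁)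
    (h₂ : IsGeodesicOn cov γ₂ s₂) {t : ℝ} (ht₁ : t ∈ s₁) (ht₂ : t ∈ s₂)
    (h : velocity (E := E) γ₁ t = velocity γ₂ t) :
    EqOn (velocity (E := E) γ₁) (velocity γ₂) (s₁ ∩ s₂) := by
  have hconn : IsPreconnected (s₁ ∩ s₂) := (h₁.ordConnected.inter h₂.ordConnected).isPreconnected
  -- This set is open by construction. It is closed relative to `s₁ ∩ s₂` because the tangent bundle
  -- is Hausdorff and equality of velocities at one time spreads to a neighbourhood.
  set u : Set ℝ := {r | velocity (E := E) γ₁ =ᶠ[𝓝 r] velocity γ₂} with hu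
  have hsub : s₁ ∩ s₂ ⊆ u := by
    refine hconn.subset_of_closure_inter_subset isOpen_setOfPred_eventually_nhds
      ⟨t, ⟨ht₁, ht₂⟩, velocity_eventuallyEq h₁ h₂ ht₁ ht₂ h⟩ ?_
    rintro r ⟨hr, hr₁, hr₂⟩
    have : (𝓝[u] r).NeBot := mem_closure_iff_nhdsWithin_neBot.1 hr
    refine velocity_eventuallyEq h₁ h₂ hr₁ hr₂ (tendsto_nhds_unique_of_eventuallyEq (l := 𝓝[u] r)
      ((h₁.continuousAt_velocity hr₁).mono_left nhdsWithin_le_nhds)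
      ((h₂.continuousAt_velocity hr₂).mono_left nhdsWithin_le_nhds) ?_)
    filter_upwards [self_mem_nhdsWithin] with x hx using hx.self_of_nhds
  exact fun r hr => (hsub hr).self_of_nhds

theorem IsGeodesicOn.eqOn {γ₁ γ₂ : ℝ → M} {s₁ s₂ : Set ℝ} (h₁ : IsGeodesicOn cov γ₁ s₁)
    (h₂ : IsGeodesicOn cov γ₂ s₂) {t : ℝ} (ht₁ : t ∈ s₁) (ht₂ : t ∈ s₂)
    (h : velocity (E := E) γ₁ t = velocity γ₂ t) : EqOn γ₁ γ₂ (s₁ ∩ s₂) := fun _ hr =>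
  congrArg TotalSpace.proj (h₁.eqOn_velocity h₂ ht₁ ht₂ h hr)

omit [T2Space M] [CovariantDerivative.ContMDiffCovariantDerivative cov ∞]
  [FiniteDimensional ℝ E] in
lemma IsGeodesicOn.union {γ : ℝ → M} {s₁ s₂ : Set ℝ} (h₁ : IsGeodesicOn cov γ s₁)
    (h₂ : IsGeodesicOn cov γ s₂) (h : (s₁ ∩ s₂).Nonempty) : IsGeodesicOn cov γ (s₁ ∪ s₂) :=
  isGeodesicOn_of_forall_mem
    (h₁.ordConnected.isPreconnected.union' h h₂.ordConnected.isPreconnected).ordConnected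
    fun _ ht => ht.elim (fun ht => ⟨s₁, subset_union_left, ht, h₁⟩)
      fun ht => ⟨s₂, subset_union_right, ht, h₂⟩

/-- Two geodesics with the same velocity at one time can be glued. -/
theorem IsGeodesicOn.exists_glue {γ₁ γ₂ : ℝ → M} {s₁ s₂ : Set ℝ} (h₁ : IsGeodesicOn cov γ₁ s₁)
    (h₂ : IsGeodesicOn cov γ₂ s₂) {t : ℝ} (ht₁ : t ∈ s₁) (ht₂ : t ∈ s₂)
    (h : velocity (E := E) γ₁ t = velocity γ₂ t) :
    ∃ γ, IsGeodesicOn cov γ (s₁ ∪ s₂) ∧ EqOn γ γ₁ s₁ ∧ EqOn γ γ₂ s₂ := by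
  classical
  have e₁ : EqOn (s₁.piecewise γ₁ γ₂) γ₁ s₁ := s₁.piecewise_eqOn _ _
  have e₂ : EqOn (s₁.piecewise γ₁ γ₂) γ₂ s₂ := by
    intro r hr
    by_cases hr₁ : r ∈ s₁
    · rw [e₁ hr₁]
      exact h₁.eqOn h₂ ht₁ ht₂ h ⟨hr₁, hr⟩
    · exact s₁.piecewise_eq_of_notMem _ _ hr₁
  exact ⟨_, (h₁.congr e₁.symm).union (h₂.congr e₂.symm) ⟨t, ht₁, ht₂⟩, e₁, e₂⟩

variable (cov) in
/-- The geodesic flow takes `v` to `w` in time `T`. -/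
def Reaches (v : TangentBundle 𝓘(ℝ, E) M) (T : ℝ) (w : TangentBundle 𝓘(ℝ, E) M) : Prop :=
  ∃ (γ : ℝ → M) (s : Set ℝ), 0 ∈ s ∧ T ∈ s ∧ IsGeodesicOn cov γ s ∧ velocity γ 0 = v ∧
    velocity γ T = w

/-- The second geodesic, delayed by `T`, is glued to the first one at time `T`. -/
lemma Reaches.trans {v w z : TangentBundle 𝓘(ℝ, E) M} {T τ : ℝ} (h₁ : Reaches cov v T w)
    (h₂ : Reaches cov w τ z) : Reaches cov v (T + τ) z := by
  obtain ⟨γ₁, s₁, h0, hT, hg₁, hv, hw⟩ := h₁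
  obtain ⟨γ₂, s₂, h0', hτ, hg₂, hw', hz⟩ := h₂
  have hg₃ := hg₂.comp_affine 1 (-T)
  have hT₃ : T ∈ (fun r : ℝ => 1 * r + -T) ⁻¹' s₂ := by simpa using h0'
  have hτ₃ : T + τ ∈ (fun r : ℝ => 1 * r + -T) ⁻¹' s₂ := by simpa using hτ
  have hvel : ∀ r, 1 * r + -T ∈ s₂ → velocity (E := E) (fun r => γ₂ (1 * r + -T)) r =
      velocity γ₂ (1 * r + -T) := fun r hr => by
    rw [velocity_comp_affine (hg₂.mdifferentiableAt _ hr), scale_one]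
  have e₁ : (1 : ℝ) * T + -T = 0 := by ring
  have e₂ : (1 : ℝ) * (T + τ) + -T = τ := by ring
  obtain ⟨γ, hγ, hγ₁, hγ₂⟩ := hg₁.exists_glue hg₃ hT hT₃ (by rw [hvel T hT₃, e₁, hw, hw'])
  refine ⟨γ, _, Or.inl h0, Or.inr hτ₃, hγ, ?_, ?_⟩
  · rw [← hv]
    exact (hg₁.velocity_eq hγ₁.symm h0).symm
  · exact (hg₃.velocity_eq hγ₂.symm hτ₃).symm.trans (by rw [hvel _ hτ₃, e₂, hz])

omit [CovariantDerivative.ContMDiffCovariantDerivative cov ∞] [T2Space M] in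
lemma Reaches.scale {v w : TangentBundle 𝓘(ℝ, E) M} {T a : ℝ} (h : Reaches cov v (a * T) w) :
    Reaches cov (scale a v) T (scale a w) := by
  obtain ⟨γ, s, h0, hT, hg, hv, hw⟩ := h
  refine ⟨_, _, by simpa using h0, by simpa using hT, hg.comp_affine a 0, ?_, ?_⟩
  · rw [velocity_comp_affine (hg.mdifferentiableAt _ (by simpa using h0)), mul_zero, add_zero, hv]
  · rw [velocity_comp_affine (hg.mdifferentiableAt _ (by simpa using hT)), add_zero, hw]

omit [CovariantDerivative.ContMDiffCovariantDerivative cov ∞] [T2Space M]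
  [FiniteDimensional ℝ E] in
lemma mem_expDomain_iff {v : TangentBundle 𝓘(ℝ, E) M} :
    v ∈ expDomain cov ↔ ∃ w, Reaches cov v 1 w :=
  ⟨fun ⟨γ, s, h0, h1, hg, hv⟩ => ⟨_, γ, s, h0, h1, hg, hv, rfl⟩,
    fun ⟨_, γ, s, h0, h1, hg, hv, _⟩ => ⟨γ, s, h0, h1, hg, hv⟩⟩

lemma Reaches.expMap_eq {v w : TangentBundle 𝓘(ℝ, E) M} (h : Reaches cov v 1 w) :
    expMap cov v = w.proj := by
  obtain ⟨γ, s, h0, h1, hg, hv, rfl⟩ := h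
  have hD : ∃ γ : ℝ → M, IsUnitTimeGeodesic cov v γ := ⟨γ, s, h0, h1, hg, hv⟩
  rw [expMap, dif_pos hD]
  obtain ⟨s', h0', h1', hg', hv'⟩ := hD.choose_spec
  exact hg'.eqOn hg h0' h0 (hv'.trans hv.symm) ⟨h1', h1⟩

/-- The velocity at time `T` of a geodesic depends continuously on its initial velocity. -/
theorem eventually_reaches {γ : ℝ → M} {s : Set ℝ} (hγ : IsGeodesicOn cov γ s) (h0 : 0 ∈ s)
    {T : ℝ} (hT : T ∈ s) {W : Set (TangentBundle 𝓘(ℝ, E) M)}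
    (hW : W ∈ 𝓝 (velocity (E := E) γ T)) :
    ∀ᶠ v in 𝓝 (velocity (E := E) γ 0), ∃ w ∈ W, Reaches cov v T w := by
  set c := velocity (E := E) γ
  let P : ℝ → Prop := fun T => ∀ W ∈ 𝓝 (c T), ∀ᶠ v in 𝓝 (c 0), ∃ w ∈ W, Reaches cov v T w
  -- One local flow near `c t`, valid for times in `(-ε, ε)`, carries `c r` to `c r'` when `r` and
  -- `r'` are both within `ε / 2` of `t`. Hence `P` is locally constant on `s`, and connectedness
  -- carries it from `0` to `T`.
  have hloc : ∀ t ∈ s, ∀ᶠ r in 𝓝[s] t, ∀ᶠ r' in 𝓝[s] t, P r → P r' := by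
    intro t ht
    obtain ⟨ε, hε, N, hN, g, hg⟩ := exists_local_geodesic_flow cov (c t)
    have hO : ∀ᶠ r in 𝓝[s] t, r ∈ s ∧ N ∈ 𝓝 (c r) ∧ r ∈ Ioo (t - ε / 2) (t + ε / 2) := by
      have h₁ : ∀ᶠ r in 𝓝 t, N ∈ 𝓝 (c r) :=
        (hγ.continuousAt_velocity ht).eventually (eventually_mem_nhds_iff.2 hN)
      filter_upwards [self_mem_nhdsWithin, nhdsWithin_le_nhds h₁, nhdsWithin_le_nhds
        (Ioo_mem_nhds (show t - ε / 2 < t by linarith) (show t < t + ε / 2 by linarith))]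
        with r hr hr' hr'' using ⟨hr, hr', hr''⟩
    filter_upwards [hO] with r hr
    filter_upwards [hO] with r' hr' hP W hW
    have hτ : r' - r ∈ Ioo (-ε) ε := by
      have := hr.2.2; have := hr'.2.2
      simp only [mem_Ioo] at *
      constructor <;> linarith
    have hε0 : (0 : ℝ) ∈ Ioo (-ε) ε := ⟨by linarith, hε⟩
    have hreach : ∀ w ∈ N, Reaches cov w (r' - r) (velocity (g w) (r' - r)) := fun w hw =>
      ⟨g w, _, hε0, hτ, (hg w hw).1, (hg w hw).2.1, rfl⟩
    have hcr : velocity (E := E) (g (c r)) (r' - r) = c r' := by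
      have hNr := mem_of_mem_nhds hr.2.1
      have hγ' := hγ.comp_affine 1 r
      have h0' : (0 : ℝ) ∈ (fun x : ℝ => 1 * x + r) ⁻¹' s := by simpa using hr.1
      have h1' : r' - r ∈ (fun x : ℝ => 1 * x + r) ⁻¹' s := by simpa using hr'.1
      have hv : ∀ x, 1 * x + r ∈ s → velocity (E := E) (fun x => γ (1 * x + r)) x =
          c (1 * x + r) := fun x hx => by
        rw [velocity_comp_affine (hγ.mdifferentiableAt _ hx), scale_one]
      have := (hg _ hNr).1.eqOn_velocity hγ' hε0 h0' (by
        rw [(hg _ hNr).2.1, hv 0 h0']; simp) ⟨hτ, h1'⟩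
      rw [this, hv _ h1']
      simp
    have hW' : (fun w => velocity (E := E) (g w) (r' - r)) ⁻¹' W ∈ 𝓝 (c r) := by
      refine ((hg _ (mem_of_mem_nhds hr.2.1)).2.2 _ hτ) ?_
      change W ∈ 𝓝 (velocity (E := E) (g (c r)) (r' - r))
      rwa [hcr]
    filter_upwards [hP _ (inter_mem hW' hr.2.1)] with v ⟨w, hw, hvw⟩
    refine ⟨_, hw.1, ?_⟩
    have := hvw.trans (hreach w hw.2)
    rwa [add_sub_cancel] at this
  have hP0 : P 0 := by
    intro W hW
    obtain ⟨ε, hε, N, hN, g, hg⟩ := exists_local_geodesic_flow cov (c 0)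
    filter_upwards [hW, hN] with v hv hv'
    have hε0 : (0 : ℝ) ∈ Ioo (-ε) ε := ⟨by linarith, hε⟩
    exact ⟨v, hv, g v, _, hε0, hε0, (hg v hv').1, (hg v hv').2.1, (hg v hv').2.1⟩
  have hiff : P 0 ↔ P T := by
    refine hγ.ordConnected.isPreconnected.induction₂ (fun x y => P x ↔ P y) (fun x hx => ?_)
      (fun x y z _ _ _ => Iff.trans) (fun x y _ _ => Iff.symm) h0 hT
    have h₁ := hloc x hx
    have h₂ : ∀ᶠ r' in 𝓝[s] x, P x → P r' := h₁.self_of_nhdsWithin hx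
    filter_upwards [h₁, h₂] with r hr hr'
    exact ⟨hr', hr.self_of_nhdsWithin hx⟩
  exact hiff.1 hP0 W hW

variable (cov) in
theorem isOpen_expDomain : IsOpen (expDomain cov) := by
  refine isOpen_iff_mem_nhds.2 fun v hv => ?_
  obtain ⟨w, γ, s, h0, h1, hg, rfl, rfl⟩ := mem_expDomain_iff.1 hv
  filter_upwards [eventually_reaches hg h0 h1 univ_mem] with v' ⟨w, _, hw⟩
  exact mem_expDomain_iff.2 ⟨w, hw⟩

theorem continuousAt_expMap {v : TangentBundle 𝓘(ℝ, E) M} (hv : v ∈ expDomain cov) :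
    ContinuousAt (expMap cov) v := by
  obtain ⟨w, h⟩ := mem_expDomain_iff.1 hv
  intro O hO
  rw [h.expMap_eq] at hO
  obtain ⟨γ, s, h0, h1, hg, rfl, rfl⟩ := h
  have hp : Continuous (TotalSpace.proj : TangentBundle 𝓘(ℝ, E) M → M) :=
    FiberBundle.continuous_proj E _
  change ∀ᶠ v' in 𝓝 _, expMap cov v' ∈ O
  filter_upwards [eventually_reaches hg h0 h1 (hp.continuousAt hO)] with v' ⟨w, hwO, hw⟩
  rw [hw.expMap_eq]
  exact hwO

variable (cov) in
lemma reaches_zero (v : TangentBundle 𝓘(ℝ, E) M) : Reaches cov v 0 v := by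
  obtain ⟨ε, hε, N, hN, g, hg⟩ := exists_local_geodesic_flow cov v
  have hε0 : (0 : ℝ) ∈ Ioo (-ε) ε := ⟨by linarith, hε⟩
  have hv := mem_of_mem_nhds hN
  exact ⟨g v, _, hε0, hε0, (hg v hv).1, (hg v hv).2.1, (hg v hv).2.1⟩

lemma mem_timeInterval_iff {w : TangentBundle 𝓘(ℝ, E) M} {t : ℝ} :
    t ∈ timeInterval cov w ↔ ∃ z, Reaches cov w t z := by
  -- Time zero is separate because the other case rescales by `t⁻¹`.
  rcases eq_or_ne t 0 with rfl | ht
  · refine iff_of_true (mem_expDomain_iff.2 ⟨scale 0 w, ?_⟩) ⟨w, reaches_zero cov w⟩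
    exact Reaches.scale (by simpa using reaches_zero cov w)
  · refine mem_expDomain_iff.trans ⟨fun ⟨z, hz⟩ => ⟨scale t⁻¹ z, ?_⟩, fun ⟨z, hz⟩ =>
      ⟨scale t z, Reaches.scale (by simpa using hz)⟩⟩
    have : Reaches cov (scale t⁻¹ (scale t w)) t (scale t⁻¹ z) :=
      Reaches.scale (by simpa [inv_mul_cancel₀ ht] using hz)
    simpa [scale_scale, inv_mul_cancel₀ ht] using this

lemma Reaches.expMap_scale_eq {w z : TangentBundle 𝓘(ℝ, E) M} {t : ℝ} (h : Reaches cov w t z) :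
    expMap cov (AffineGeodesics.scale t w) = z.proj :=
  (Reaches.scale (T := 1) (a := t) (by simpa using h)).expMap_eq

variable (cov) in
lemma isOpen_timeInterval (w : TangentBundle 𝓘(ℝ, E) M) : IsOpen (timeInterval cov w) :=
  (isOpen_expDomain cov).preimage (continuous_scale.comp (by fun_prop : Continuous fun t => (t, w)))

variable (cov) in
lemma zero_mem_timeInterval (w : TangentBundle 𝓘(ℝ, E) M) : 0 ∈ timeInterval cov w :=
  mem_timeInterval_iff.2 ⟨w, reaches_zero cov w⟩

lemma mem_timeInterval_of_isGeodesicOn {γ : ℝ → M} {s : Set ℝ} (hγ : IsGeodesicOn cov γ s)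
    (h0 : 0 ∈ s) {t : ℝ} (ht : t ∈ s) : t ∈ timeInterval cov (velocity (E := E) γ 0) :=
  mem_timeInterval_iff.2 ⟨_, γ, s, h0, ht, hγ, rfl, rfl⟩

lemma expMap_scale_velocity {γ : ℝ → M} {s : Set ℝ} (hγ : IsGeodesicOn cov γ s)
    (h0 : 0 ∈ s) {t : ℝ} (ht : t ∈ s) :
    expMap cov (scale t (velocity (E := E) γ 0)) = γ t :=
  Reaches.expMap_scale_eq ⟨γ, s, h0, ht, hγ, rfl, rfl⟩

variable (cov) in
-- A geodesic defined at `0` and `t` is defined in between; this is the star-shapedness of `𝒟`.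
lemma ordConnected_timeInterval (w : TangentBundle 𝓘(ℝ, E) M) :
    (timeInterval cov w).OrdConnected := by
  have key : ∀ t ∈ timeInterval cov w, uIcc 0 t ⊆ timeInterval cov w := by
    intro t ht
    obtain ⟨z, γ, s, h0, hts, hg, rfl, -⟩ := mem_timeInterval_iff.1 ht
    exact fun r hr => mem_timeInterval_of_isGeodesicOn hg h0 (hg.ordConnected.uIcc_subset h0 hts hr)
  refine ⟨fun a ha b hb x hx => ?_⟩
  rcases le_total 0 x with h | h
  · exact key b hb (by rw [uIcc_of_le (h.trans hx.2)]; exact ⟨h, hx.2⟩)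
  · exact key a ha (by rw [uIcc_of_ge (hx.1.trans h)]; exact ⟨hx.1, h⟩)

variable (cov) in
lemma isGeodesicOn_expMap_scale (w : TangentBundle 𝓘(ℝ, E) M) :
    IsGeodesicOn cov (fun t => expMap cov (scale t w)) (timeInterval cov w) := by
  refine isGeodesicOn_of_forall_mem (ordConnected_timeInterval cov w) fun t ht => ?_
  obtain ⟨z, γ, s, h0, hts, hg, rfl, -⟩ := mem_timeInterval_iff.1 ht
  exact ⟨s, fun r hr => mem_timeInterval_of_isGeodesicOn hg h0 hr, hts,
    hg.congr fun r hr => (expMap_scale_velocity hg h0 hr).symm⟩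

variable (cov) in
lemma velocity_expMap_scale_zero (w : TangentBundle 𝓘(ℝ, E) M) :
    velocity (fun t => expMap cov (scale t w)) 0 = w := by
  obtain ⟨γ, s, h0, -, hg, rfl, -⟩ := reaches_zero cov w
  exact (hg.velocity_eq (fun r hr => (expMap_scale_velocity hg h0 hr).symm) h0).symm

variable (cov) in
-- An extension still has velocity `w` at time `0`, so each of its times belongs to `J_w`.
theorem isMaximalGeodesic_expMap_scale (w : TangentBundle 𝓘(ℝ, E) M) :
    IsMaximalGeodesic cov (fun t => expMap cov (scale t w)) (timeInterval cov w) := by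
  have hg := isGeodesicOn_expMap_scale cov w
  have h0 := zero_mem_timeInterval cov w
  refine ⟨hg, ⟨0, h0⟩, fun γ' s' hg' hs' he t ht => ?_⟩
  have := mem_timeInterval_of_isGeodesicOn hg' (hs' h0) ht
  rwa [← hg.velocity_eq he.symm h0, velocity_expMap_scale_zero] at this

/-- The maximal extension of a nontrivial piece of `t ↦ exp (t w)` is `t ↦ exp (t w)` on its
maximal interval of definition. -/
theorem IsMaximalGeodesic.eq_timeInterval {w : TangentBundle 𝓘(ℝ, E) M} {γ : ℝ → M}
    {s I : Set ℝ} (h : IsMaximalGeodesic cov γ s) (hI : I.OrdConnected) (hI' : I.Nontrivial)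
    (hIs : I ⊆ s) (hIw : I ⊆ timeInterval cov w)
    (he : EqOn γ (fun t => expMap cov (scale t w)) I) :
    s = timeInterval cov w ∧ EqOn γ (fun t => expMap cov (scale t w)) s := by
  have hg := isGeodesicOn_expMap_scale cov w
  obtain ⟨a, ha, b, hb, hab⟩ := hI'.exists_lt
  have hsub : Ioo a b ⊆ I := Ioo_subset_Icc_self.trans (hI.out ha hb)
  -- Equality on `I` determines the velocity only at interior points, and `I` need not be open.
  -- Maximality of each curve then absorbs the domain of the other.
  have hmid : (a + b) / 2 ∈ Ioo a b := ⟨by linarith, by linarith⟩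
  have hvel : velocity (E := E) γ ((a + b) / 2) =
      velocity (fun t => expMap cov (scale t w)) ((a + b) / 2) :=
    velocity_eq_of_eventuallyEq
      ((he.mono hsub).eventuallyEq_of_mem (isOpen_Ioo.mem_nhds hmid))
  have hms := hIs (hsub hmid)
  have hmw := hIw (hsub hmid)
  obtain ⟨γ', hγ', e₁, -⟩ := h.isGeodesicOn.exists_glue hg hms hmw hvel
  have hws : timeInterval cov w ⊆ s :=
    subset_union_right.trans (h.maximal γ' _ hγ' subset_union_left e₁)
  have heq := h.isGeodesicOn.eqOn hg hms hmw hvel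
  rw [inter_eq_right.2 hws] at heq
  have hsw : s ⊆ timeInterval cov w :=
    (isMaximalGeodesic_expMap_scale cov w).maximal γ s h.isGeodesicOn hws heq
  have := hsw.antisymm hws
  exact ⟨this, by rwa [this]⟩

end Exponential

/-! ### Bounds on tangent vectors from the auxiliary metric. -/

section Norm

variable {E : Type*} [NormedAddCommGroup E] [NormedSpace ℝ E]
  {M : Type*} [TopologicalSpace M] [ChartedSpace E M] [IsManifold 𝓘(ℝ, E) ∞ M]
  (h : SmoothRiemannianMetric E M)

lemma continuous_hNorm : Continuous (hNorm h) := by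
  let _ : RiemannianBundle (fun x : M => TangentSpace 𝓘(ℝ, E) x) := ⟨h.toRiemannianMetric⟩
  have h₁ : ContMDiff 𝓘(ℝ, E).tangent 𝓘(ℝ, ℝ) ∞ (fun v : TangentBundle 𝓘(ℝ, E) M =>
      inner ℝ (v.snd : TangentSpace 𝓘(ℝ, E) v.proj) v.snd) :=
    ContMDiff.inner_bundle (IB := 𝓘(ℝ, E)) (F := E)
      (b := (TotalSpace.proj : TangentBundle 𝓘(ℝ, E) M → M))
      (v := fun v => v.snd) (w := fun v => v.snd) contMDiff_id contMDiff_id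
  exact h₁.continuous.sqrt

lemma hNorm_nonneg (v : TangentBundle 𝓘(ℝ, E) M) : 0 ≤ hNorm h v := Real.sqrt_nonneg _

lemma hNorm_scale (t : ℝ) (v : TangentBundle 𝓘(ℝ, E) M) :
    hNorm h (scale t v) = |t| * hNorm h v := by
  have : h.inner v.proj (t • v.snd) (t • v.snd) = t ^ 2 * h.inner v.proj v.snd v.snd := by
    simp only [map_smul, smul_apply, smul_eq_mul]
    ring
  simp only [hNorm]
  rw [← Real.sqrt_sq_eq_abs, ← Real.sqrt_mul (sq_nonneg t)]
  exact congrArg _ this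

lemma hNorm_pos {v : TangentBundle 𝓘(ℝ, E) M} (hv : v ∉ zeroVectors E M) : 0 < hNorm h v :=
  Real.sqrt_pos.2 (h.pos v.proj v.snd hv)

lemma notMem_zeroVectors_of_hNorm_pos {v : TangentBundle 𝓘(ℝ, E) M} (hv : 0 < hNorm h v) :
    v ∉ zeroVectors E M := by
  intro h0
  have h0' : v.snd = 0 := h0
  simp [hNorm, h0'] at hv

lemma hNorm_of_mem_unitVectors {C : Set (TangentBundle 𝓘(ℝ, E) M)} {w : TangentBundle 𝓘(ℝ, E) M}
    (hw : w ∈ unitVectors h C) : hNorm h w = 1 := by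
  obtain ⟨v, hv, rfl⟩ := hw
  have := hNorm_pos h hv.2
  rw [hNorm_scale, abs_of_pos (inv_pos.2 this), inv_mul_cancel₀ this.ne']

/-- The filter pulled back along the projection makes the bound uniform over entire fibres, with no
restriction on the size of the vectors. -/
lemma eventually_norm_trivialization_le (x : M) :
    ∃ B : ℝ, ∀ᶠ v : TangentBundle 𝓘(ℝ, E) M in comap TotalSpace.proj (𝓝 x),
      ‖(trivializationAt E (fun x : M => TangentSpace 𝓘(ℝ, E) x) x v).2‖ ≤ B * hNorm h v := by
  let _ : RiemannianBundle (fun x : M => TangentSpace 𝓘(ℝ, E) x) := ⟨h.toRiemannianMetric⟩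
  have : IsContinuousRiemannianBundle E (fun x : M => TangentSpace 𝓘(ℝ, E) x) :=
    ⟨h.inner, h.contMDiff.continuous, fun _ _ _ => rfl⟩
  obtain ⟨B, hB, hev⟩ := eventually_norm_trivializationAt_lt E
    (fun x : M => TangentSpace 𝓘(ℝ, E) x) x
  refine ⟨B, ?_⟩
  have hb := (trivializationAt E (fun x : M => TangentSpace 𝓘(ℝ, E) x) x).open_baseSet.mem_nhds
    (mem_baseSet_trivializationAt _ _ _)
  filter_upwards [preimage_mem_comap hev, preimage_mem_comap hb] with v hv hv'
  have h₁ := ContinuousLinearMap.le_of_opNorm_le _ (le_of_lt hv) v.snd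
  rw [Trivialization.continuousLinearMapAt_apply_of_mem (R := ℝ) _ hv'] at h₁
  exact h₁

variable [FiniteDimensional ℝ E]

/-- Bounded subsets of the tangent bundle over a convergent family of base points are relatively
compact. -/
lemma exists_le_nhds_of_hNorm_le {F : Ultrafilter (TangentBundle 𝓘(ℝ, E) M)} {x : M} {R : ℝ}
    (hF : Tendsto TotalSpace.proj (F : Filter (TangentBundle 𝓘(ℝ, E) M)) (𝓝 x))
    (hn : ∀ᶠ v in (F : Filter (TangentBundle 𝓘(ℝ, E) M)), hNorm h v ≤ R) :
    ∃ w, (F : Filter (TangentBundle 𝓘(ℝ, E) M)) ≤ 𝓝 w := by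
  set e := trivializationAt E (fun x : M => TangentSpace 𝓘(ℝ, E) x) x
  have hb : x ∈ e.baseSet := mem_baseSet_trivializationAt _ _ _
  obtain ⟨B, hB⟩ := eventually_norm_trivialization_le h x
  have hbd : ∀ᶠ v in (F : Filter (TangentBundle 𝓘(ℝ, E) M)),
      (e v).2 ∈ Metric.closedBall (0 : E) (|B| * R) := by
    filter_upwards [hF.le_comap hB, hn] with v hv hv'
    rw [mem_closedBall_zero_iff]
    have := hNorm_nonneg h v
    calc ‖(e v).2‖ ≤ B * hNorm h v := hv
      _ ≤ |B| * hNorm h v := by gcongr; exact le_abs_self B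
      _ ≤ |B| * R := by gcongr
  obtain ⟨c, -, hc⟩ := (isCompact_closedBall (0 : E) (|B| * R)).ultrafilter_le_nhds
    (F.map fun v => (e v).2) (tendsto_principal.2 hbd)
  have hc' : Tendsto (fun v => (e v).2) (F : Filter (TangentBundle 𝓘(ℝ, E) M)) (𝓝 c) := hc
  refine ⟨e.toOpenPartialHomeomorph.symm (x, c), ?_⟩
  have h₁ : Tendsto (fun v : TangentBundle 𝓘(ℝ, E) M =>
      e.toOpenPartialHomeomorph.symm (v.proj, (e v).2)) F
      (𝓝 (e.toOpenPartialHomeomorph.symm (x, c))) :=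
    (e.toOpenPartialHomeomorph.continuousAt_symm (e.mem_target.2 hb)).tendsto.comp
      (hF.prodMk_nhds hc')
  refine (h₁.congr' ?_ : Tendsto id _ _)
  filter_upwards [hF (e.open_baseSet.mem_nhds hb)] with v hv
  exact e.symm_apply_mk_proj (e.mem_source.2 hv)

end Norm

/-! ### Properness against pseudoconvexity and disprisonment. -/

section Properness

variable {E : Type*} [NormedAddCommGroup E] [NormedSpace ℝ E] [FiniteDimensional ℝ E]
  {M : Type*} [TopologicalSpace M] [ChartedSpace E M] [IsManifold 𝓘(ℝ, E) ∞ M] [T2Space M]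
  {cov : AffineConnection E M} [CovariantDerivative.ContMDiffCovariantDerivative cov ∞]
  {h : SmoothRiemannianMetric E M} {C : Set (TangentBundle 𝓘(ℝ, E) M)}

omit [FiniteDimensional ℝ E] [T2Space M]
  [CovariantDerivative.ContMDiffCovariantDerivative cov ∞] in
lemma hasCompactPreimages_iff :
    HasCompactPreimages (fun v : C => expMap cov v) ↔
      ∀ K : Set M, IsCompact K → IsCompact (C ∩ expMap cov ⁻¹' K) := by
  refine forall₂_congr fun K _ => ?_
  rw [Topology.IsEmbedding.subtypeVal.isCompact_iff]
  have : ((↑) : C → TangentBundle 𝓘(ℝ, E) M) '' ((fun v : C => expMap cov v) ⁻¹' K) =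
      C ∩ expMap cov ⁻¹' K := Subtype.image_preimage_coe C (expMap cov ⁻¹' K)
  rw [this]

omit [FiniteDimensional ℝ E] [T2Space M]
  [CovariantDerivative.ContMDiffCovariantDerivative cov ∞] in
lemma scale_mem_of_mem_timeInterval (hP2 : PropertyP2 cov C) {w : TangentBundle 𝓘(ℝ, E) M}
    (hw : w ∈ unitVectors h C) {t : ℝ} (ht : t ∈ timeInterval cov w) : scale t w ∈ C := by
  obtain ⟨v, hv, rfl⟩ := hw
  exact hP2 v hv ⟨⟨t * (hNorm h v)⁻¹, (scale_scale _ _ _).symm⟩, ht⟩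

lemma scale_mem_expDomain {v : TangentBundle 𝓘(ℝ, E) M} (hv : v ∈ expDomain cov) {r : ℝ}
    (hr : r ∈ Icc (0 : ℝ) 1) : scale r v ∈ expDomain cov :=
  (ordConnected_timeInterval cov v).out (zero_mem_timeInterval cov v)
    (show scale 1 v ∈ expDomain cov by rwa [scale_one]) hr

variable (cov) in
lemma expMap_scale_zero (w : TangentBundle 𝓘(ℝ, E) M) : expMap cov (scale 0 w) = w.proj :=
  (reaches_zero cov w).expMap_scale_eq

/-- The compact set for `K` is the image under `exp` of all contractions, by factors in `[0, 1]`, of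
vectors in `C ∩ exp⁻¹ K`. -/
theorem isPseudoconvex_of_isCompact_preimages (hCD : C ⊆ expDomain cov) (hP2 : PropertyP2 cov C)
    (hproper : ∀ K : Set M, IsCompact K → IsCompact (C ∩ expMap cov ⁻¹' K)) :
    IsPseudoconvex (geodesicClass cov h C) := by
  intro K hK
  set S := (fun p : ℝ × TangentBundle 𝓘(ℝ, E) M => scale p.1 p.2) ''
    (Icc (0 : ℝ) 1 ×ˢ (C ∩ expMap cov ⁻¹' K)) with hS
  have hScomp : IsCompact S := (isCompact_Icc.prod (hproper K hK)).image continuous_scale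
  have hSD : S ⊆ expDomain cov := by
    rintro _ ⟨⟨r, v⟩, ⟨hr, hv⟩, rfl⟩
    exact scale_mem_expDomain (hCD hv.1) hr
  refine ⟨expMap cov '' S, hScomp.image_of_continuousOn fun v hv =>
    (continuousAt_expMap (hSD hv)).continuousWithinAt, ?_⟩
  rintro ⟨I, γ⟩ ⟨hI, -, w, hw, hIJ, hγ⟩ a ha b hb hab haK hbK
  rintro _ ⟨x, hx, rfl⟩
  have hend : ∀ t ∈ I, γ t ∈ K → scale t w ∈ C ∩ expMap cov ⁻¹' K := fun t ht htK =>
    ⟨scale_mem_of_mem_timeInterval hP2 hw (hIJ ht), by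
      rw [mem_preimage, ← hγ t ht]; exact htK⟩
  have hxI : x ∈ I := hI.out ha hb hx
  refine ⟨scale x w, ?_, (hγ x hxI).symm⟩
  have key : ∀ t ∈ I, γ t ∈ K → (∃ r ∈ Icc (0 : ℝ) 1, x = r * t) → scale x w ∈ S := by
    rintro t ht htK ⟨r, hr, rfl⟩
    exact ⟨(r, scale t w), ⟨hr, hend t ht htK⟩, scale_scale _ _ _⟩
  -- A time `x ≥ 0` lies in `[0, b]` and a time `x ≤ 0` in `[a, 0]`, so the endpoint on the side of
  -- `x` is contracted. If that endpoint is `0`, then `x = 0` and the quotient takes its default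
  -- value `0`.
  rcases le_total 0 x with h0 | h0
  · refine key b hb hbK ⟨x / b, ⟨div_nonneg h0 (h0.trans hx.2),
      div_le_one_of_le₀ hx.2 (h0.trans hx.2)⟩, ?_⟩
    rcases eq_or_ne b 0 with hb0 | hb0
    · rw [hb0, mul_zero]
      exact le_antisymm (hb0 ▸ hx.2) h0
    · rw [div_mul_cancel₀ _ hb0]
  · refine key a ha haK ⟨x / a, ⟨div_nonneg_of_nonpos h0 (hx.1.trans h0),
      div_le_one_of_ge hx.1 (hx.1.trans h0)⟩, ?_⟩
    rcases eq_or_ne a 0 with ha0 | ha0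
    · rw [ha0, mul_zero]
      exact le_antisymm h0 (ha0 ▸ hx.1)
    · rw [div_mul_cancel₀ _ ha0]

omit [FiniteDimensional ℝ E] [CovariantDerivative.ContMDiffCovariantDerivative cov ∞] in
/-- The times at which a geodesic starting in a unit vector of `C` lies in a given compact set form
a compact set. -/
lemma isCompact_setOf_expMap_scale_mem
    (hproper : ∀ K : Set M, IsCompact K → IsCompact (C ∩ expMap cov ⁻¹' K))
    {w : TangentBundle 𝓘(ℝ, E) M} (hw : w ∈ unitVectors h C) {K : Set M} (hK : IsCompact K) :
    IsCompact ((fun t => scale t w) ⁻¹' (C ∩ expMap cov ⁻¹' K)) := by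
  have hcont : Continuous fun t : ℝ => scale t w :=
    continuous_scale.comp (by fun_prop : Continuous fun t : ℝ => (t, w))
  have hKt := hproper K hK
  refine Metric.isCompact_of_isClosed_isBounded (hKt.isClosed.preimage hcont) ?_
  obtain ⟨R, hR⟩ := (hKt.image (continuous_hNorm h)).bddAbove
  refine (Metric.isBounded_closedBall (x := (0 : ℝ)) (r := R)).subset fun t ht => ?_
  have := hR ⟨_, ht, rfl⟩
  rw [hNorm_scale, hNorm_of_mem_unitVectors h hw, mul_one] at this
  simpa using this

lemma exists_gt_and_lt_of_isOpen {s : Set ℝ} (hs : IsOpen s) {m : ℝ} (hm : m ∈ s) :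
    (∃ r ∈ s, m < r) ∧ ∃ r ∈ s, r < m := by
  obtain ⟨l, u, hlu, hsub⟩ := mem_nhds_iff_exists_Ioo_subset.1 (hs.mem_nhds hm)
  exact ⟨⟨(m + u) / 2, hsub ⟨by linarith [hlu.1, hlu.2], by linarith [hlu.2]⟩,
      by linarith [hlu.2]⟩,
    ⟨(l + m) / 2, hsub ⟨by linarith [hlu.1], by linarith [hlu.1, hlu.2]⟩, by linarith [hlu.1]⟩⟩

theorem isDisprisoning_of_isCompact_preimages (hCD : C ⊆ expDomain cov) (hP2 : PropertyP2 cov C)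
    (hproper : ∀ K : Set M, IsCompact K → IsCompact (C ∩ expMap cov ⁻¹' K)) :
    IsDisprisoning cov (geodesicClass cov h C) := by
  rintro ⟨I, γ₀⟩ ⟨hI, hI', w, hw, hIJ, hγ₀⟩ γ s hγ hIs he t₀ ht₀
  obtain ⟨rfl, heq⟩ := hγ.eq_timeInterval (w := w) hI hI' hIs hIJ
    fun t ht => (he ht).trans (hγ₀ t ht)
  have hopen := isOpen_timeInterval cov w
  have hsub : ∀ {A : Set ℝ}, A ⊆ timeInterval cov w → IsCompact (closure (γ '' A)) →
      A ⊆ (fun t => scale t w) ⁻¹' (C ∩ expMap cov ⁻¹' closure (γ '' A)) := fun hA _ t ht =>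
    ⟨scale_mem_of_mem_timeInterval hP2 hw (hA ht),
      subset_closure ⟨t, ht, heq (hA ht)⟩⟩
  have hback : ∀ {K : Set M}, (fun t => scale t w) ⁻¹' (C ∩ expMap cov ⁻¹' K) ⊆
      timeInterval cov w := fun {K} t ht => hCD ht.1
  constructor
  · intro hcomp
    have hS := (isCompact_setOf_expMap_scale_mem hproper hw hcomp).inter_right
      (isClosed_Ici (a := t₀))
    obtain ⟨m, hm, hmax⟩ := hS.exists_isGreatest
      ⟨t₀, hsub inter_subset_left hcomp ⟨ht₀, self_mem_Ici⟩, self_mem_Ici⟩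
    -- `J_w` is open, so it contains a time after the last one `m`; that time also belongs to the
    -- forward half, hence to the compact set.
    obtain ⟨r, hr, hmr⟩ := (exists_gt_and_lt_of_isOpen hopen (hback hm.1)).1
    have hr₀ : r ∈ Ici t₀ := le_trans hm.2 hmr.le
    exact absurd (hmax ⟨hsub inter_subset_left hcomp ⟨hr, hr₀⟩, hr₀⟩) (not_le.2 hmr)
  · intro hcomp
    have hS := (isCompact_setOf_expMap_scale_mem hproper hw hcomp).inter_right
      (isClosed_Iic (a := t₀))
    obtain ⟨m, hm, hmin⟩ := hS.exists_isLeast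
      ⟨t₀, hsub inter_subset_left hcomp ⟨ht₀, self_mem_Iic⟩, self_mem_Iic⟩
    obtain ⟨r, hr, hmr⟩ := (exists_gt_and_lt_of_isOpen hopen (hback hm.1)).2
    have hr₀ : r ∈ Iic t₀ := le_trans hmr.le hm.2
    exact absurd (hmin ⟨hsub inter_subset_left hcomp ⟨hr, hr₀⟩, hr₀⟩) (not_le.2 hmr)

omit [FiniteDimensional ℝ E] [T2Space M]
  [CovariantDerivative.ContMDiffCovariantDerivative cov ∞] in
/-- Polar coordinates on `C`. -/
lemma exists_unitVector_scale_eq (hP1 : PropertyP1 C) {v : TangentBundle 𝓘(ℝ, E) M}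
    (hv : v ∈ C) : ∃ w ∈ unitVectors h C, ∃ t : ℝ, 0 ≤ t ∧ scale t w = v := by
  by_cases h0 : v ∈ zeroVectors E M
  · obtain ⟨v', hv', hp⟩ := hP1 v hv
    refine ⟨_, ⟨v', hv', rfl⟩, 0, le_rfl, ?_⟩
    obtain ⟨x, u⟩ := v
    obtain ⟨x', u'⟩ := v'
    obtain rfl : x' = x := hp
    obtain rfl : u = 0 := h0
    exact congrArg (TotalSpace.mk x') (zero_smul ℝ _)
  · have := hNorm_pos h h0
    exact ⟨_, ⟨v, ⟨hv, h0⟩, rfl⟩, hNorm h v, this.le, by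
      rw [scale_scale, mul_inv_cancel₀ this.ne', scale_one]⟩

/-- (P1) gives a nonzero vector over the same point, and (P2) puts its multiple by `0` in `C`.
Compactness of `C ∩ 𝒵` thereby controls all base points of `C`. -/
lemma proj_mem_image_zeroVectors (hP1 : PropertyP1 C) (hP2 : PropertyP2 cov C)
    {v : TangentBundle 𝓘(ℝ, E) M} (hv : v ∈ C) :
    v.proj ∈ TotalSpace.proj '' (C ∩ zeroVectors E M) := by
  obtain ⟨v', hv', hp⟩ := hP1 v hv
  refine ⟨scale 0 v', ⟨hP2 v' hv' ⟨⟨0, rfl⟩, zero_mem_timeInterval cov v'⟩, ?_⟩, hp⟩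
  exact zero_smul ℝ v'.snd

omit [FiniteDimensional ℝ E] [T2Space M]
  [CovariantDerivative.ContMDiffCovariantDerivative cov ∞] in
-- `C` is closed only relative to `𝒟`, so a limit of vectors of `C` must be known to lie in `𝒟`.
lemma mem_of_mem_closure (hCD : C ⊆ expDomain cov)
    (hclosed : IsClosed ((↑) ⁻¹' C : Set (expDomain cov))) {u : TangentBundle 𝓘(ℝ, E) M}
    (hu : u ∈ expDomain cov) (huC : u ∈ closure C) : u ∈ C := by
  obtain ⟨C', hC', heq⟩ := isClosed_induced_iff.1 hclosed
  have hsub : C ⊆ C' := fun v hv => by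
    have : (⟨v, hCD hv⟩ : expDomain cov) ∈ ((↑) ⁻¹' C : Set (expDomain cov)) := hv
    rwa [← heq] at this
  have : (⟨u, hu⟩ : expDomain cov) ∈ ((↑) ⁻¹' C' : Set (expDomain cov)) :=
    closure_minimal hsub hC' huC
  rwa [heq] at this

theorem isCompact_preimage_of_isPseudoconvex_of_isDisprisoning (hCD : C ⊆ expDomain cov)
    (hP1 : PropertyP1 C) (hP2 : PropertyP2 cov C) (hcomp : IsCompact (C ∩ zeroVectors E M))
    (hclosed : IsClosed ((↑) ⁻¹' C : Set (expDomain cov)))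
    (hps : IsPseudoconvex (geodesicClass cov h C))
    (hdis : IsDisprisoning cov (geodesicClass cov h C)) {K : Set M} (hK : IsCompact K) :
    IsCompact (C ∩ expMap cov ⁻¹' K) := by
  refine isCompact_iff_ultrafilter_le_nhds'.2 fun F hF => ?_
  have hscale : ∀ r : ℝ, Continuous fun v : TangentBundle 𝓘(ℝ, E) M => scale r v := fun r =>
    continuous_scale.comp (by fun_prop : Continuous fun v : TangentBundle 𝓘(ℝ, E) M => (r, v))
  have hproj : Continuous (TotalSpace.proj : TangentBundle 𝓘(ℝ, E) M → M) :=
    FiberBundle.continuous_proj E _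
  -- Polar coordinates are chosen on the whole bundle, arbitrarily off `C`, so that the ultrafilter
  -- can be pushed forward.
  have hchoice : ∀ v : TangentBundle 𝓘(ℝ, E) M, ∃ p : TangentBundle 𝓘(ℝ, E) M × ℝ, v ∈ C →
      p.1 ∈ unitVectors h C ∧ 0 ≤ p.2 ∧ scale p.2 p.1 = v := by
    intro v
    by_cases hv : v ∈ C
    · obtain ⟨w, hw, t, ht, hwt⟩ := exists_unitVector_scale_eq (h := h) hP1 hv
      exact ⟨(w, t), fun _ => ⟨hw, ht, hwt⟩⟩
    · exact ⟨(v, 0), fun hv' => absurd hv' hv⟩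
  choose p hp using hchoice
  set B := TotalSpace.proj '' (C ∩ zeroVectors E M) with hB
  have hBcomp : IsCompact B := hcomp.image hproj
  have hpB : ∀ v ∈ C, (p v).1.proj ∈ B := fun v hv => by
    have : (scale (p v).2 (p v).1).proj ∈ B := by
      rw [(hp v hv).2.2]
      exact proj_mem_image_zeroVectors hP1 hP2 hv
    exact this
  have hFC : ∀ᶠ v in (F : Filter (TangentBundle 𝓘(ℝ, E) M)), v ∈ C ∧ expMap cov v ∈ K := hF
  -- limit of the directions
  obtain ⟨x, -, hx⟩ := hBcomp.ultrafilter_le_nhds (F.map fun v => (p v).1.proj)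
    (tendsto_principal.2 (hFC.mono fun v hv => hpB v hv.1))
  obtain ⟨w, hw⟩ := exists_le_nhds_of_hNorm_le h (F := F.map fun v => (p v).1) (x := x) (R := 1)
    hx (hFC.mono fun v hv => (hNorm_of_mem_unitVectors h (hp v hv.1).1).le)
  have hw' : Tendsto (fun v => (p v).1) F (𝓝 w) := hw
  have hw1 : hNorm h w = 1 := by
    refine tendsto_nhds_unique (((continuous_hNorm h).tendsto w).comp hw')
      (tendsto_const_nhds.congr' ?_)
    filter_upwards [hFC] with v hv using (hNorm_of_mem_unitVectors h (hp v hv.1).1).symm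
  have hscale_tendsto : ∀ r : ℝ, Tendsto (fun v => scale r (p v).1) F (𝓝 (scale r w)) := fun r =>
    ((hscale r).tendsto w).comp hw'
  have hev : ∀ r ∈ timeInterval cov w, ∀ᶠ v in (F : Filter (TangentBundle 𝓘(ℝ, E) M)),
      r ∈ timeInterval cov (p v).1 := fun r hr =>
    hscale_tendsto r ((isOpen_expDomain cov).mem_nhds hr)
  have hwC : w ∈ unitVectors h C := by
    -- The vector `w` itself need not lie in `𝒟`, so closedness is applied to a short multiple `δ
    -- w`, whose normalization is `w`.
    obtain ⟨⟨δ, hδ, hδ0⟩, -⟩ :=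
      exists_gt_and_lt_of_isOpen (isOpen_timeInterval cov w) (zero_mem_timeInterval cov w)
    have hmem : scale δ w ∈ C := by
      refine mem_of_mem_closure hCD hclosed hδ (mem_closure_of_tendsto (hscale_tendsto δ) ?_)
      filter_upwards [hFC, hev δ hδ] with v hv hv'
      exact scale_mem_of_mem_timeInterval hP2 (hp v hv.1).1 hv'
    have hn : hNorm h (scale δ w) = δ := by rw [hNorm_scale, hw1, mul_one, abs_of_pos hδ0]
    refine ⟨scale δ w, ⟨hmem, notMem_zeroVectors_of_hNorm_pos h (hn.symm ▸ hδ0)⟩, ?_⟩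
    change scale (hNorm h (scale δ w))⁻¹ (scale δ w) = w
    rw [hn, scale_scale, inv_mul_cancel₀ hδ0.ne', scale_one]
  -- limit of the times
  obtain ⟨τ, -, hτ⟩ := isCompact_univ.ultrafilter_le_nhds (F.map fun v => ((p v).2 : EReal))
    (by simp)
  have hτ' : Tendsto (fun v => ((p v).2 : EReal)) F (𝓝 τ) := hτ
  have hτ0 : 0 ≤ τ := by
    refine ge_of_tendsto hτ' ?_
    filter_upwards [hFC] with v hv
    exact_mod_cast (hp v hv.1).2.1
  by_cases hfin : ∃ t ∈ timeInterval cov w, τ = ((t : ℝ) : EReal)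
  · obtain ⟨t, ht, rfl⟩ := hfin
    have ht' : Tendsto (fun v => (p v).2) F (𝓝 t) := EReal.tendsto_coe.1 hτ'
    have hlim : (F : Filter (TangentBundle 𝓘(ℝ, E) M)) ≤ 𝓝 (scale t w) := by
      have h₁ : Tendsto (fun v => scale (p v).2 (p v).1) F (𝓝 (scale t w)) :=
        (continuous_scale.tendsto (t, w)).comp (ht'.prodMk_nhds hw')
      refine (h₁.congr' ?_ : Tendsto id _ _)
      filter_upwards [hFC] with v hv using (hp v hv.1).2.2
    refine ⟨scale t w, ⟨mem_of_mem_closure hCD hclosed ht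
      (mem_closure_of_tendsto (f := id) hlim (hFC.mono fun v hv => hv.1)), ?_⟩, hlim⟩
    exact hK.isClosed.mem_of_tendsto ((continuousAt_expMap ht).mono_left hlim)
      (hFC.mono fun v hv => hv.2)
  · exfalso
    -- Otherwise `0 ≤ τ ≤ r` makes `τ` a real number in the interval `J_w`.
    have hlt : ∀ r ∈ timeInterval cov w, (r : EReal) < τ := by
      intro r hr
      by_contra hcon
      have hle : τ ≤ r := not_lt.1 hcon
      lift τ to ℝ using ⟨ne_top_of_le_ne_top (EReal.coe_ne_top r) hle,
        ne_bot_of_le_ne_bot (by simp) hτ0⟩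
      exact hfin ⟨τ, (ordConnected_timeInterval cov w).out (zero_mem_timeInterval cov w) hr
        ⟨by exact_mod_cast hτ0, by exact_mod_cast hle⟩, rfl⟩
    -- The approximating segments start at base points, in `B`, and end in `K`; each fixed time `r`
    -- is eventually smaller than their length.
    obtain ⟨K', hK', hseg⟩ := hps (K ∪ B) (hK.union hBcomp)
    have hmem : (fun t => expMap cov (scale t w)) '' (timeInterval cov w ∩ Ici 0) ⊆ K' := by
      rintro _ ⟨r, ⟨hr, hr0⟩, rfl⟩
      refine hK'.isClosed.mem_of_tendsto
        ((continuousAt_expMap hr).tendsto.comp (hscale_tendsto r)) ?_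
      filter_upwards [hFC, hτ'.eventually (lt_mem_nhds (hlt r hr))] with v hv hrv
      have hrv' : r < (p v).2 := by exact_mod_cast hrv
      have ht0 : 0 < (p v).2 := lt_of_le_of_lt hr0 hrv'
      have htv : (p v).2 ∈ timeInterval cov (p v).1 := by
        change scale (p v).2 (p v).1 ∈ expDomain cov
        rw [(hp v hv.1).2.2]
        exact hCD hv.1
      refine hseg (Icc 0 (p v).2, fun t => expMap cov (scale t (p v).1))
        ⟨ordConnected_Icc, ⟨0, left_mem_Icc.2 ht0.le, _, right_mem_Icc.2 ht0.le, ht0.ne⟩,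
          (p v).1, (hp v hv.1).1, (ordConnected_timeInterval cov _).out
            (zero_mem_timeInterval cov _) htv, fun _ _ => rfl⟩
        0 (left_mem_Icc.2 ht0.le) _ (right_mem_Icc.2 ht0.le) ht0.le (Or.inr ?_) (Or.inl ?_)
        ⟨r, ⟨hr0, hrv'.le⟩, rfl⟩
      · change expMap cov (scale 0 (p v).1) ∈ B
        rw [expMap_scale_zero]
        exact hpB v hv.1
      · change expMap cov (scale (p v).2 (p v).1) ∈ K
        rw [(hp v hv.1).2.2]
        exact hv.2
    obtain ⟨⟨δ, hδ, hδ0⟩, -⟩ :=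
      exists_gt_and_lt_of_isOpen (isOpen_timeInterval cov w) (zero_mem_timeInterval cov w)
    exact (hdis (timeInterval cov w, fun t => expMap cov (scale t w))
      ⟨ordConnected_timeInterval cov w, ⟨0, zero_mem_timeInterval cov w, δ, hδ, hδ0.ne⟩,
        w, hwC, subset_rfl, fun _ _ => rfl⟩ _ _ (isMaximalGeodesic_expMap_scale cov w)
      subset_rfl (fun _ _ => rfl) 0 (zero_mem_timeInterval cov w)).1
      (hK'.of_isClosed_subset isClosed_closure (closure_minimal hmem hK'.isClosed))

end Properness

end AffineGeodesics

end

theorem theorem3p5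
    {E : Type*} [NormedAddCommGroup E] [NormedSpace ℝ E] [FiniteDimensional ℝ E]
    (hdim : 2 ≤ Module.finrank ℝ E)
    {M : Type*} [TopologicalSpace M] [ChartedSpace E M] [IsManifold 𝓘(ℝ, E) ∞ M]
    [T2Space M] [SecondCountableTopology M] [ConnectedSpace M]
    (cov : AffineGeodesics.AffineConnection E M)
    [CovariantDerivative.ContMDiffCovariantDerivative cov ∞]
    (h : AffineGeodesics.SmoothRiemannianMetric E M)
    (hh : AffineGeodesics.IsCompleteMetric h)
    (C : Set (TangentBundle 𝓘(ℝ, E) M)) (hC : C.Nonempty)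
    (hCD : C ⊆ AffineGeodesics.expDomain cov)
    (hP1 : AffineGeodesics.PropertyP1 C)
    (hP2 : AffineGeodesics.PropertyP2 cov C) :
    (AffineGeodesics.HasCompactPreimages (fun v : C => AffineGeodesics.expMap cov v) →
      AffineGeodesics.IsPseudoconvex (AffineGeodesics.geodesicClass cov h C) ∧
      AffineGeodesics.IsDisprisoning cov (AffineGeodesics.geodesicClass cov h C)) ∧
    (IsCompact (C ∩ AffineGeodesics.zeroVectors E M) →
      IsClosed ((↑) ⁻¹' C : Set (AffineGeodesics.expDomain cov)) →
      AffineGeodesics.IsPseudoconvex (AffineGeodesics.geodesicClass cov h C) →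
      AffineGeodesics.IsDisprisoning cov (AffineGeodesics.geodesicClass cov h C) →
      AffineGeodesics.HasCompactPreimages (fun v : C => AffineGeodesics.expMap cov v)) := by
  rw [AffineGeodesics.hasCompactPreimages_iff]
  exact ⟨fun hproper =>
      ⟨AffineGeodesics.isPseudoconvex_of_isCompact_preimages hCD hP2 hproper,
        AffineGeodesics.isDisprisoning_of_isCompact_preimages hCD hP2 hproper⟩,
    fun hcomp hclosed hps hdis _ hK =>
      AffineGeodesics.isCompact_preimage_of_isPseudoconvex_of_isDisprisoning
        hCD hP1 hP2 hcomp hclosed hps hdis hK⟩
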